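/- Let $n\ge 2$, let $0=k_1<k_2<\dots<k_n=k$ be integers with $\gcd(k_2,\dots,k_n)=1$, and let $A=\begin{bmatrix}1&1&\cdots&1\\ k_1&k_2&\cdots&k_n\end{bmatrix}$, with columns $a_i$. Let $I_A=\langle \partial^u-\partial^w \mid u,w\in\mathbb N^n,\ Au=Aw\rangle\subseteq\mathbb C[\partial]=\mathbb C[\partial_1,\dots,\partial_n]$. For $\beta\in\mathbb C^2$ let $H_A(\beta)$ be the left ideal of the Weyl algebra generated by $I_A$ and by the Euler operators $\sum_j a_{ij}x_j\partial_j-\beta_i$, $i=1,2$. The rank of $H_A(\beta)$ is the dimension of the space of germs of holomorphic solutions at a nonsingular point, that is, a point $x\in\mathbb C^n$ with $x_1x_n\ne 0$ such that $\sum_i x_iz^{k_i}$ has no repeated root $z\in\mathbb C^*$. Let $\mathcal E_A=\{\beta\in\mathbb C^2\mid \operatorname{rank}H_A(\beta)>k\}$ be the set of rank-jumping parameters; here $k$ is the normalized volume of $A$. Suppose $N=\beta_2$ is a nonnegative integer. Let $P$ be the set of ordered partitions $p$ of $N$ with parts in $\{k_2,\dots,k_n\}$; let $|p|$ be the length of $p$,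 $s_i(p)$ its $i$th partial sum, $m_i(p)$ the number of parts of $p$ equal to $k_i$, and let $\ell$ be the least length of an element of $P$. Put $$\varphi(x)=x_1^{\beta_1}\sum_{p\in P}\Big(\prod_{i=\ell}^{|p|-1}(\beta_1-i)\Big)\Big(\prod_{i=1}^{|p|-1}\frac1{N-s_i(p)}\Big)\prod_{i=2}^n k_i^{m_i(p)}\Big(\frac{x_i}{x_1}\Big)^{m_i(p)};$$ this is the finitely supported solution of $H_A(\beta)$ along the line of all parameters with second coordinate $N$ (the factors $\beta_1-i$, $1\le i<\ell$, common to all coefficients of the specialized Euler–Mellin integral, have been removed). If $N'=k\beta_1-\beta_2$ is a nonnegative integer, let $\varphi'$ be given by the same formula with $N$, $x_1$ and the parts $k_i$ ($2\le i\le n$) replaced by $N'$, $x_n$ and the parts $k-k_i$ ($1\le i\le n-1$). Equip $\mathbb C[\partial]/I_A$, its localizations and its local cohomology with the $\mathbb Z^2$-grading in which $\deg\partial_i=a_i$, and compute $H^\bullet_{\langle\partial\rangle}(\mathbb C[\partial]/I_A)$ as the cohomology of the Ishida complex $$0\to\frac{\mathbb C[\partial]}{I_A}\xrightarrow{\ \delta^0\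 }\Big(\frac{\mathbb C[\partial]}{I_A}\Big)_{\partial_1}\oplus\Big(\frac{\mathbb C[\partial]}{I_A}\Big)_{\partial_n}\xrightarrow{\ \delta^1\ }\Big(\frac{\mathbb C[\partial]}{I_A}\Big)_{\partial_1\partial_n}\to0,\qquad \delta^0(r)=(r,r),\quad \delta^1(a,b)=b-a.$$ Theorem. Let $\beta\in\mathcal E_A$. Then $\beta\in\mathbb Z^2$, $\beta_2$ and $k\beta_1-\beta_2$ are nonnegative integers, and $\varphi$ and $\varphi'$ are nonzero. If $x^v$ and $x^{v'}$ are monomials appearing with nonzero coefficients in $\varphi$ and $\varphi'$ respectively, then $v,v'\in\mathbb Z^n$, $v_i\ge0$ for $i\neq1$, $v'_i\ge0$ for $i\ne n$, and $$(\partial^v,\partial^{v'})\in\Big(\frac{\mathbb C[\partial]}{I_A}\Big)_{\partial_1}\oplus\Big(\frac{\mathbb C[\partial]}{I_A}\Big)_{\partial_n}$$ is a cocycle, $\delta^1(\partial^v,\partial^{v'})=0$, whose class in $H^1_{\langle\partial\rangle}(\mathbb C[\partial]/I_A)$ is nonzero and spans the graded component $[H^1_{\langle\partial\rangle}(\mathbb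 C[\partial]/I_A)]_\beta$ over $\mathbb C$. -/

import Mathlib

open scoped Topology

noncomputable section

namespace MonomialCurve

/-! ### The matrix and its toric ideal -/

/-- The `2 × n` integer matrix whose `j`-th column is `(1, k j)`. -/
def curveMatrix {n : ℕ} (k : Fin n → ℕ) : Matrix (Fin 2) (Fin n) ℤ :=
  Matrix.of ![fun _ => 1, fun j => (k j : ℤ)]

/-- The toric ideal `⟨∂^u - ∂^w ∣ A u = A w⟩ ⊆ ℂ[∂₁, …, ∂ₙ]`. -/
def toricIdeal {d n : ℕ} (A : Matrix (Fin d) (Fin n) ℤ) : Ideal (MvPolynomial (Fin n) ℂ) :=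
  Ideal.span {P | ∃ u w : Fin n →₀ ℕ,
    A.mulVec (fun j => (u j : ℤ)) = A.mulVec (fun j => (w j : ℤ)) ∧
    P = MvPolynomial.monomial u 1 - MvPolynomial.monomial w 1}

/-! ### Solutions of the hypergeometric system, rank, rank-jumping parameters -/

/-- The partial derivative `∂f/∂x_i`. -/
def partialD {n : ℕ} (i : Fin n) (f : (Fin n → ℂ) → ℂ) : (Fin n → ℂ) → ℂ :=
  fun x => fderiv ℂ f x (Pi.single i 1)

/-- The iterated partial derivative `∂₁^{u₁} ⋯ ∂ₙ^{uₙ} f`. -/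
def monomialD {n : ℕ} (u : Fin n →₀ ℕ) (f : (Fin n → ℂ) → ℂ) : (Fin n → ℂ) → ℂ :=
  (List.finRange n).foldr (fun i g => (partialD i)^[u i] g) f

/-- The action on functions of the constant coefficient operator `P(∂)`. -/
def polyD {n : ℕ} (P : MvPolynomial (Fin n) ℂ) (f : (Fin n → ℂ) → ℂ) : (Fin n → ℂ) → ℂ :=
  fun x => ∑ u ∈ P.support, P.coeff u * monomialD u f x

/-- The action on functions of the Euler operator `∑ⱼ a_{ij} xⱼ ∂ⱼ - βᵢ`. -/
def eulerD {d n : ℕ} (A : Matrix (Fin d) (Fin n) ℤ) (β : Fin d → ℂ) (i : Fin d)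
    (f : (Fin n → ℂ) → ℂ) : (Fin n → ℂ) → ℂ :=
  fun x => ∑ j, (A i j : ℂ) * x j * partialD j f x - β i * f x

/-- `f` is holomorphic near `p` and is annihilated near `p` by `I_A` and by the Euler operators,
that is, by the left ideal `H_A(β)` of the Weyl algebra that they generate. -/
structure IsSolutionAt {d n : ℕ} (A : Matrix (Fin d) (Fin n) ℤ) (β : Fin d → ℂ)
    (p : Fin n → ℂ) (f : (Fin n → ℂ) → ℂ) : Prop where
  analyticAt : AnalyticAt ℂ f p
  toric : ∀ P ∈ toricIdeal A, polyD P f =ᶠ[𝓝 p] 0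
  euler : ∀ i, eulerD A β i f =ᶠ[𝓝 p] 0

section Linearity

variable {n : ℕ} {p : Fin n → ℂ} {f g : (Fin n → ℂ) → ℂ}

theorem analyticAt_partialD (hf : AnalyticAt ℂ f p) (i : Fin n) :
    AnalyticAt ℂ (partialD i f) p := by
  have h := ((ContinuousLinearMap.apply ℂ ℂ (Pi.single i (1 : ℂ) : Fin n → ℂ)).analyticAt
    (fderiv ℂ f p)).comp hf.fderiv
  exact h

theorem partialD_congr (h : f =ᶠ[𝓝 p] g) (i : Fin n) : partialD i f =ᶠ[𝓝 p] partialD i g := by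
  filter_upwards [h.fderiv (𝕜 := ℂ)] with x hx
  simp only [partialD, hx]

theorem partialD_comb (hf : AnalyticAt ℂ f p) (hg : AnalyticAt ℂ g p) (c : ℂ) (i : Fin n) :
    partialD i (fun x => f x + c * g x) =ᶠ[𝓝 p] fun x => partialD i f x + c * partialD i g x := by
  filter_upwards [hf.eventually_analyticAt, hg.eventually_analyticAt] with x hfx hgx
  have hg' := hgx.differentiableAt
  simp only [partialD]
  rw [fderiv_fun_add hfx.differentiableAt (hg'.const_mul c), fderiv_const_mul hg' c]
  simp

theorem monomialD_spec (hf : AnalyticAt ℂ f p) (hg : AnalyticAt ℂ g p) (c : ℂ)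
    (u : Fin n →₀ ℕ) (l : List (Fin n)) :
    AnalyticAt ℂ (l.foldr (fun i g => (partialD i)^[u i] g) f) p ∧
    AnalyticAt ℂ (l.foldr (fun i g => (partialD i)^[u i] g) g) p ∧
    l.foldr (fun i g => (partialD i)^[u i] g) (fun x => f x + c * g x) =ᶠ[𝓝 p]
      fun x => l.foldr (fun i g => (partialD i)^[u i] g) f x
        + c * l.foldr (fun i g => (partialD i)^[u i] g) g x := by
  induction l with
  | nil => exact ⟨hf, hg, Filter.EventuallyEq.rfl⟩
  | cons i l ih =>
    simp only [List.foldr_cons]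
    generalize u i = r
    induction r with
    | zero => exact ih
    | succ r ihr =>
      simp only [Function.iterate_succ_apply']
      exact ⟨analyticAt_partialD ihr.1 i, analyticAt_partialD ihr.2.1 i,
        (partialD_congr ihr.2.2 i).trans (partialD_comb ihr.1 ihr.2.1 c i)⟩

theorem polyD_comb (hf : AnalyticAt ℂ f p) (hg : AnalyticAt ℂ g p) (c : ℂ)
    (P : MvPolynomial (Fin n) ℂ) :
    polyD P (fun x => f x + c * g x) =ᶠ[𝓝 p] fun x => polyD P f x + c * polyD P g x := by
  have h : ∀ᶠ x in 𝓝 p, ∀ u ∈ P.support, monomialD u (fun x => f x + c * g x) x =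
      monomialD u f x + c * monomialD u g x :=
    (Finset.eventually_all P.support).2 fun u _ => (monomialD_spec hf hg c u _).2.2
  filter_upwards [h] with x hx
  simp only [polyD]
  rw [Finset.sum_congr rfl fun u hu => by rw [hx u hu], Finset.mul_sum, ← Finset.sum_add_distrib]
  exact Finset.sum_congr rfl fun u _ => by ring

theorem eulerD_comb {d : ℕ} (A : Matrix (Fin d) (Fin n) ℤ) (β : Fin d → ℂ) (i : Fin d)
    (hf : AnalyticAt ℂ f p) (hg : AnalyticAt ℂ g p) (c : ℂ) :
    eulerD A β i (fun x => f x + c * g x) =ᶠ[𝓝 p]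
      fun x => eulerD A β i f x + c * eulerD A β i g x := by
  have h : ∀ᶠ x in 𝓝 p, ∀ j, partialD j (fun x => f x + c * g x) x =
      partialD j f x + c * partialD j g x :=
    Filter.eventually_all.2 fun j => partialD_comb hf hg c j
  filter_upwards [h] with x hx
  simp only [eulerD, hx, mul_add, mul_sub, Finset.sum_add_distrib, Finset.mul_sum]
  have : ∀ j, (A i j : ℂ) * x j * (c * partialD j g x) = c * ((A i j : ℂ) * x j * partialD j g x) :=
    fun j => by ring
  simp only [this]
  ring

theorem IsSolutionAt.comb {d : ℕ} {A : Matrix (Fin d) (Fin n) ℤ} {β : Fin d → ℂ}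
    (hf : IsSolutionAt A β p f) (hg : IsSolutionAt A β p g) (c : ℂ) :
    IsSolutionAt A β p (fun x => f x + c * g x) where
  analyticAt := hf.analyticAt.add (analyticAt_const.mul hg.analyticAt)
  toric P hP := by
    filter_upwards [polyD_comb hf.analyticAt hg.analyticAt c P, hf.toric P hP, hg.toric P hP]
      with x h1 h2 h3
    rw [h1, h2, h3]; simp
  euler i := by
    filter_upwards [eulerD_comb A β i hf.analyticAt hg.analyticAt c, hf.euler i, hg.euler i]
      with x h1 h2 h3
    rw [h1, h2, h3]; simp

theorem isSolutionAt_zero {d : ℕ} (A : Matrix (Fin d) (Fin n) ℤ) (β : Fin d → ℂ) :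
    IsSolutionAt A β p (fun _ => 0) := by
  have h1 : ∀ i : Fin n, partialD i (fun _ => (0 : ℂ)) = fun _ => 0 := fun i => by
    funext x; simp [partialD]
  have h2 : ∀ u : Fin n →₀ ℕ, monomialD u (fun _ => (0 : ℂ)) = fun _ => 0 := fun u => by
    unfold monomialD
    induction List.finRange n with
    | nil => rfl
    | cons i l ih =>
      rw [List.foldr_cons, ih]
      exact Function.iterate_fixed (h1 i) _
  refine ⟨analyticAt_const, fun P _ => ?_, fun i => ?_⟩
  · exact Filter.Eventually.of_forall fun x => by simp [polyD, h2]
  · exact Filter.Eventually.of_forall fun x => by simp [eulerD, h1]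

end Linearity

/-- The complex vector space of germs at `p` of holomorphic solutions of `H_A(β)`. -/
def solutionGerms {d n : ℕ} (A : Matrix (Fin d) (Fin n) ℤ) (β : Fin d → ℂ) (p : Fin n → ℂ) :
    Submodule ℂ ((𝓝 p).Germ ℂ) where
  carrier := {φ | ∃ f : (Fin n → ℂ) → ℂ, IsSolutionAt A β p f ∧ φ = (f : (𝓝 p).Germ ℂ)}
  add_mem' := by
    rintro _ _ ⟨f, hf, rfl⟩ ⟨g, hg, rfl⟩
    refine ⟨_, hf.comb hg 1, ?_⟩
    rw [← Filter.Germ.coe_add]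
    congr 1
    funext x
    simp
  zero_mem' := ⟨_, isSolutionAt_zero A β, rfl⟩
  smul_mem' := by
    rintro c _ ⟨f, hf, rfl⟩
    refine ⟨_, (isSolutionAt_zero A β).comb hf c, ?_⟩
    rw [← Filter.Germ.coe_smul]
    congr 1
    funext x
    simp

variable {m : ℕ}

/-- The polynomial `f(z) = ∑ᵢ xᵢ z^{kᵢ}`. -/
def curvePolynomial (k : Fin (m + 2) → ℕ) (x : Fin (m + 2) → ℂ) : Polynomial ℂ :=
  ∑ i, Polynomial.C (x i) * Polynomial.X ^ k i

/-- The complement of the singular locus: `x₁ xₙ ≠ 0`, and `f` has no repeated root in `ℂ^*`. -/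
def nonsingularLocus (k : Fin (m + 2) → ℕ) : Set (Fin (m + 2) → ℂ) :=
  {x | x 0 ≠ 0 ∧ x (Fin.last (m + 1)) ≠ 0 ∧
    ¬ ∃ z : ℂ, z ≠ 0 ∧ (curvePolynomial k x).IsRoot z ∧
      (Polynomial.derivative (curvePolynomial k x)).IsRoot z}

/-- The set of rank-jumping parameters: those `β` for which the space of germs of solutions of
`H_A(β)` at a nonsingular point has dimension greater than the normalized volume `kₙ` of `A`. -/
def rankJumping (k : Fin (m + 2) → ℕ) : Set (Fin 2 → ℂ) :=
  {β | ∀ p ∈ nonsingularLocus k,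
    (k (Fin.last (m + 1)) : Cardinal) < Module.rank ℂ (solutionGerms (curveMatrix k) β p)}

/-! ### The finitely supported solutions along the polar lines

Both series have the same shape. For the line `β₂ = N` take the base index `b = 1` and
`d i = k i`; for the line `kβ₁ - β₂ = N` take `b = n` and `d i = kₙ - k i`. -/

/-- The ordered partitions of `N` all of whose parts belong to `{d i ∣ i ≠ b}`. -/
def orderedPartitions (d : Fin (m + 2) → ℕ) (b : Fin (m + 2)) (N : ℕ) : Finset (Composition N) :=
  open scoped Classical in
  Finset.univ.filter fun c => ∀ a ∈ c.blocks, ∃ i, i ≠ b ∧ d i = a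

/-- The least length of an ordered partition of `N` with parts in `{d i ∣ i ≠ b}`. -/
def minLength (d : Fin (m + 2) → ℕ) (b : Fin (m + 2)) (N : ℕ) : ℕ :=
  sInf (Composition.length '' (orderedPartitions d b N : Set (Composition N)))

/-- The number `mᵢ(c)` of times that the part `d i` is used in `c`, for `i ≠ b`. -/
def partMultiplicity (d : Fin (m + 2) → ℕ) {N : ℕ} (c : Composition N) (i : Fin (m + 2)) : ℕ :=
  c.blocks.count (d i)

/-- The exponent of `x_b^l ∏_{i ≠ b} (xᵢ / x_b)^{mᵢ(c)}`. -/
def polarExponent (d : Fin (m + 2) → ℕ) (b : Fin (m + 2)) (l : ℂ) {N : ℕ} (c : Composition N) :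
    Fin (m + 2) → ℂ :=
  fun i => if i = b then l - c.length else partMultiplicity d c i

/-- The coefficient belonging to `c`. It is
`∏_{i=1}^{|c|-1} (l - i)/(N - sᵢ(c)) · ∏_{i ≠ b} (d i)^{mᵢ(c)}`, where `sᵢ(c)` is the `i`-th partial
sum, after removal of the factors `l - i`, `1 ≤ i < minLength`, which are those common to all the
coefficients along the line. -/
def polarCoeff (d : Fin (m + 2) → ℕ) (b : Fin (m + 2)) (l : ℂ) {N : ℕ} (c : Composition N) : ℂ :=
  (∏ i ∈ Finset.Ico (minLength d b N) c.length, (l - i)) *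
  (∏ i ∈ Finset.Ico 1 c.length, ((N : ℂ) - c.sizeUpTo i)⁻¹) *
  ∏ i ∈ Finset.univ.erase b, (d i : ℂ) ^ partMultiplicity d c i

/-- The series as a formal finite sum of monomials `x^w`, `w ∈ ℂⁿ`: the map `w ↦` coefficient. -/
def polarSeries (d : Fin (m + 2) → ℕ) (b : Fin (m + 2)) (N : ℕ) (l : ℂ) :
    (Fin (m + 2) → ℂ) →₀ ℂ :=
  ∑ c ∈ orderedPartitions d b N, Finsupp.single (polarExponent d b l c) (polarCoeff d b l c)

/-- The finitely supported solution of `H_A(l, N)` on the line `β₂ = N`. -/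
def polarSolutionFirst (k : Fin (m + 2) → ℕ) (N : ℕ) (l : ℂ) : (Fin (m + 2) → ℂ) →₀ ℂ :=
  polarSeries k 0 N l

/-- The finitely supported solution of `H_A(l, kₙ l - N)` on the line `kₙ β₁ - β₂ = N`. -/
def polarSolutionLast (k : Fin (m + 2) → ℕ) (N : ℕ) (l : ℂ) : (Fin (m + 2) → ℂ) →₀ ℂ :=
  polarSeries (fun i => k (Fin.last (m + 1)) - k i) (Fin.last (m + 1)) N l

/-! ### The Ishida complex and its first cohomology -/

/-- The ring `ℂ[∂]/I_A`. -/
def ToricRing (k : Fin (m + 2) → ℕ) : Type :=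
  MvPolynomial (Fin (m + 2)) ℂ ⧸ toricIdeal (curveMatrix k)

instance (k : Fin (m + 2) → ℕ) : CommRing (ToricRing k) :=
  inferInstanceAs (CommRing (MvPolynomial (Fin (m + 2)) ℂ ⧸ toricIdeal (curveMatrix k)))

instance (k : Fin (m + 2) → ℕ) : Algebra ℂ (ToricRing k) :=
  inferInstanceAs (Algebra ℂ (MvPolynomial (Fin (m + 2)) ℂ ⧸ toricIdeal (curveMatrix k)))

/-- The class of `∂ᵢ` in `ℂ[∂]/I_A`. -/
def del (k : Fin (m + 2) → ℕ) (i : Fin (m + 2)) : ToricRing k :=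
  Ideal.Quotient.mk (toricIdeal (curveMatrix k)) (MvPolynomial.X i)

/-- The localization `(ℂ[∂]/I_A)_{∂_b}`. -/
abbrev AwayDel (k : Fin (m + 2) → ℕ) (b : Fin (m + 2)) : Type :=
  Localization.Away (del k b)

/-- The localization `(ℂ[∂]/I_A)_{∂₁∂ₙ}`. -/
abbrev AwayBoth (k : Fin (m + 2) → ℕ) : Type :=
  Localization.Away (del k 0 * del k (Fin.last (m + 1)))

/-- The localization map `(ℂ[∂]/I_A)_{∂₁} → (ℂ[∂]/I_A)_{∂₁∂ₙ}`. -/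
def awayFirst (k : Fin (m + 2) → ℕ) : AwayDel k 0 →ₐ[ToricRing k] AwayBoth k where
  __ := IsLocalization.Away.awayToAwayRight (S := AwayDel k 0) (P := AwayBoth k)
    (del k 0) (del k (Fin.last (m + 1)))
  commutes' r := IsLocalization.Away.awayToAwayRight_eq (S := AwayDel k 0) (P := AwayBoth k) _ _ r

/-- The localization map `(ℂ[∂]/I_A)_{∂ₙ} → (ℂ[∂]/I_A)_{∂₁∂ₙ}`. -/
def awayLast (k : Fin (m + 2) → ℕ) : AwayDel k (Fin.last (m + 1)) →ₐ[ToricRing k] AwayBoth k where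
  __ := IsLocalization.Away.awayToAwayLeft (S := AwayDel k (Fin.last (m + 1))) (P := AwayBoth k)
    (del k (Fin.last (m + 1))) (del k 0)
  commutes' r := IsLocalization.Away.awayToAwayLeft_eq
    (S := AwayDel k (Fin.last (m + 1))) (P := AwayBoth k) _ _ r

/-- The term of cohomological degree one, `(ℂ[∂]/I_A)_{∂₁} ⊕ (ℂ[∂]/I_A)_{∂ₙ}`. -/
abbrev IshidaOne (k : Fin (m + 2) → ℕ) : Type :=
  AwayDel k 0 × AwayDel k (Fin.last (m + 1))

/-- The differential `δ⁰`, `r ↦ (r, r)`. -/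
def ishidaD0 (k : Fin (m + 2) → ℕ) : ToricRing k →ₗ[ToricRing k] IshidaOne k :=
  (Algebra.linearMap (ToricRing k) (AwayDel k 0)).prod
    (Algebra.linearMap (ToricRing k) (AwayDel k (Fin.last (m + 1))))

/-- The differential `δ¹`, `(a, b) ↦ b - a`. -/
def ishidaD1 (k : Fin (m + 2) → ℕ) : IshidaOne k →ₗ[ToricRing k] AwayBoth k :=
  (awayLast k).toLinearMap ∘ₗ LinearMap.snd _ _ _ - (awayFirst k).toLinearMap ∘ₗ LinearMap.fst _ _ _

theorem ishidaD1_comp_ishidaD0 (k : Fin (m + 2) → ℕ) : ishidaD1 k ∘ₗ ishidaD0 k = 0 := by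
  refine LinearMap.ext fun r => ?_
  change awayLast k (algebraMap _ _ r) - awayFirst k (algebraMap _ _ r) = 0
  rw [AlgHom.commutes, AlgHom.commutes, sub_self]

/-- `H¹_{⟨∂⟩}(ℂ[∂]/I_A) = ker δ¹ / im δ⁰`. -/
abbrev IshidaH1 (k : Fin (m + 2) → ℕ) : Type :=
  LinearMap.ker (ishidaD1 k) ⧸ (LinearMap.range (ishidaD0 k)).submoduleOf (LinearMap.ker (ishidaD1 k))

/-- The cohomology class of a cocycle, as a `ℂ`-linear map. -/
def ishidaClass (k : Fin (m + 2) → ℕ) : LinearMap.ker (ishidaD1 k) →ₗ[ℂ] IshidaH1 k :=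
  (Submodule.mkQ _).restrictScalars ℂ

/-- The Laurent monomial `∂^v` in `(ℂ[∂]/I_A)_{∂_b}`, for `v ∈ ℤⁿ` with `vᵢ ≥ 0` for all `i ≠ b`
(negative entries at `i ≠ b` are read as zero). -/
def laurentMonomial (k : Fin (m + 2) → ℕ) (b : Fin (m + 2)) (v : Fin (m + 2) → ℤ) : AwayDel k b :=
  algebraMap (ToricRing k) (AwayDel k b) (∏ i, del k i ^ (v i).toNat) *
    IsLocalization.Away.invSelf (S := AwayDel k b) (del k b) ^ (-v b).toNat

/-- The component of degree `α ∈ ℤ²` of `(ℂ[∂]/I_A)_{∂_b}`, where `∂ᵢ` has degree the `i`-th column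
of `A`. -/
def awayGraded (k : Fin (m + 2) → ℕ) (b : Fin (m + 2)) (α : Fin 2 → ℤ) : Submodule ℂ (AwayDel k b) :=
  Submodule.span ℂ {y | ∃ v : Fin (m + 2) → ℤ, (∀ i, i ≠ b → 0 ≤ v i) ∧
    (curveMatrix k).mulVec v = α ∧ y = laurentMonomial k b v}

/-- The component of degree `α ∈ ℤ²` of `H¹_{⟨∂⟩}(ℂ[∂]/I_A)`: the classes of the cocycles that are
homogeneous of degree `α`. -/
def ishidaH1Graded (k : Fin (m + 2) → ℕ) (α : Fin 2 → ℤ) : Submodule ℂ (IshidaH1 k) :=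
  (((awayGraded k 0 α).prod (awayGraded k (Fin.last (m + 1)) α)).comap
    ((LinearMap.ker (ishidaD1 k)).subtype.restrictScalars ℂ)).map (ishidaClass k)

end MonomialCurve

end

/-! Write `K` for the last entry of `k`. Measure the degree of `∂^u` by `y = lowerDegree k u` and `x
= upperDegree k u`; in these coordinates the first column of `A` is `x = K, y = 0` and the last one
is `x = 0, y = K`.

Rank-jumping parameters are holes. Let `f` solve the system near `(1, 0, …, 0, 1)`, a nonsingular
point. The toric equations make `∂^u f` at this point depend only on `(x, y)`. The Euler operators,
differentiated, collapse there to two-term recursions along the first and last columns, with factors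
`K * β 0 - β 1 - x` and `β 1 - y`. Modulo these columns the degrees fall into at most `K` cosets,
indexed by `y` mod `K`. On a coset one value determines all others, unless both factors vanish
somewhere on the coset but never at the same degree. So rank above `K` forces `β` into `((ℕA + ℤa₁)
∩ (ℕA + ℤaₙ)) ∖ ℕA` (`exists_of_mem_rankJumping`).

In the degree of a hole the toric ring is zero, while each localization is a line that maps
isomorphically onto the same line of the double localization. Hence the cohomology is a line,
spanned by any pair of Laurent monomials of that degree (`ishidaH1Graded_eq_span`). Counting parts
shows that all exponents of the polar series have this degree. The series are nonzero, since terms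
with the same monomial differ only by positive factors, and a vanishing factor `β 0 - i` would put
`β` in `ℕA` (`polarSeries_of_degree`). -/

namespace MonomialCurve

/-! ### Calculus of iterated partial derivatives of analytic functions. -/

section Derivatives

variable {n : ℕ} {p : Fin n → ℂ} {f g : (Fin n → ℂ) → ℂ}

theorem partialD_comm (hf : AnalyticAt ℂ f p) (i j : Fin n) :
    partialD i (partialD j f) =ᶠ[𝓝 p] partialD j (partialD i f) := by
  have key : ∀ (x : Fin n → ℂ), AnalyticAt ℂ f x → ∀ a b : Fin n,
      partialD a (partialD b f) x = fderiv ℂ (fderiv ℂ f) x (Pi.single a 1) (Pi.single b 1) := by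
    intro x hx a b
    have h := hx.fderiv.differentiableAt.hasFDerivAt.clm_apply
      (hasFDerivAt_const (Pi.single b (1 : ℂ) : Fin n → ℂ) x)
    change fderiv ℂ (fun y => fderiv ℂ f y (Pi.single b 1)) x (Pi.single a 1) = _
    rw [h.fderiv]
    simp
  filter_upwards [hf.eventually_analyticAt] with x hx
  rw [key x hx, key x hx]
  exact (hx.contDiffAt (n := 2)).isSymmSndFDerivAt (by simp) _ _

theorem analyticAt_iterate_partialD (hf : AnalyticAt ℂ f p) (i : Fin n) (r : ℕ) :
    AnalyticAt ℂ ((partialD i)^[r] f) p := by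
  induction r with
  | zero => exact hf
  | succ r ih => rw [Function.iterate_succ_apply']; exact analyticAt_partialD ih i

theorem iterate_partialD_congr (h : f =ᶠ[𝓝 p] g) (i : Fin n) (r : ℕ) :
    (partialD i)^[r] f =ᶠ[𝓝 p] (partialD i)^[r] g := by
  induction r with
  | zero => exact h
  | succ r ih => simp only [Function.iterate_succ_apply']; exact partialD_congr ih i

theorem partialD_iterate_comm (hf : AnalyticAt ℂ f p) (i j : Fin n) (r : ℕ) :
    partialD i ((partialD j)^[r] f) =ᶠ[𝓝 p] (partialD j)^[r] (partialD i f) := by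
  induction r with
  | zero => exact Filter.EventuallyEq.rfl
  | succ r ih =>
    simp only [Function.iterate_succ_apply']
    exact (partialD_comm (analyticAt_iterate_partialD hf j r) i j).trans (partialD_congr ih j)

theorem analyticAt_foldr_partialD (hf : AnalyticAt ℂ f p) (u : Fin n →₀ ℕ) (l : List (Fin n)) :
    AnalyticAt ℂ (l.foldr (fun i g => (partialD i)^[u i] g) f) p := by
  induction l with
  | nil => exact hf
  | cons i l ih => exact analyticAt_iterate_partialD ih i _

theorem analyticAt_monomialD (hf : AnalyticAt ℂ f p) (u : Fin n →₀ ℕ) :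
    AnalyticAt ℂ (monomialD u f) p :=
  analyticAt_foldr_partialD hf u _

theorem partialD_foldr (hf : AnalyticAt ℂ f p) (u : Fin n →₀ ℕ) (j : Fin n) (l : List (Fin n))
    (hl : l.Nodup) (hj : j ∈ l) :
    l.foldr (fun i g => (partialD i)^[(u + Finsupp.single j 1 : Fin n →₀ ℕ) i] g) f =ᶠ[𝓝 p]
      partialD j (l.foldr (fun i g => (partialD i)^[u i] g) f) := by
  induction l with
  | nil => simp at hj
  | cons i l ih =>
    simp only [List.foldr_cons]
    rw [List.nodup_cons] at hl
    by_cases hij : i = j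
    · subst hij
      have h : l.foldr (fun a g => (partialD a)^[(u + Finsupp.single i 1 : Fin n →₀ ℕ) a] g) f =
          l.foldr (fun a g => (partialD a)^[u a] g) f := by
        refine List.foldr_ext _ _ _ fun a ha g => ?_
        have : a ≠ i := fun h => hl.1 (h ▸ ha)
        simp [this.symm]
      rw [h]
      simp [Function.iterate_succ_apply']
    · have hjl : j ∈ l := by
        rcases List.mem_cons.1 hj with h | h
        · exact absurd h.symm hij
        · exact h
      have h : (u + Finsupp.single j 1 : Fin n →₀ ℕ) i = u i := by
        simp [Ne.symm hij]
      rw [h]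
      exact (iterate_partialD_congr (ih hl.2 hjl) i _).trans
        (partialD_iterate_comm (analyticAt_foldr_partialD hf u l) j i _).symm

theorem monomialD_add_single (hf : AnalyticAt ℂ f p) (u : Fin n →₀ ℕ) (j : Fin n) :
    monomialD (u + Finsupp.single j 1) f =ᶠ[𝓝 p] partialD j (monomialD u f) :=
  partialD_foldr hf u j _ (List.nodup_finRange n) (List.mem_finRange j)

theorem monomialD_zero : monomialD (0 : Fin n →₀ ℕ) f = f := by
  unfold monomialD
  induction List.finRange n with
  | nil => rfl
  | cons i l _ => simp

/-- Unlike the standard induction on finitely supported functions, each step raises one exponent by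
one, which matches a single further differentiation. -/
theorem induction_add_single {motive : (Fin n →₀ ℕ) → Prop} (zero : motive 0)
    (add_single : ∀ u j, motive u → motive (u + Finsupp.single j 1)) (u : Fin n →₀ ℕ) :
    motive u := by
  induction hN : u.degree generalizing u with
  | zero => rw [(Finsupp.degree_eq_zero_iff u).1 hN]; exact zero
  | succ N ih =>
    obtain ⟨j, hj⟩ : ∃ j, u j ≠ 0 := by
      by_contra! hcon
      have : u = 0 := Finsupp.ext hcon
      simp [this] at hN
    have hle : Finsupp.single j 1 ≤ u := by
      simpa [Finsupp.single_le_iff] using Nat.one_le_iff_ne_zero.2 hj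
    have heq := tsub_add_cancel_of_le hle
    rw [← heq]
    refine add_single _ j (ih _ ?_)
    have := congrArg Finsupp.degree heq
    rw [map_add, hN, Finsupp.degree_single] at this
    omega

/-- The commutator of `∂ⱼ` with the `i`-th Euler operator is `A i j • ∂ⱼ`, so differentiating shifts
the parameter by the `j`-th column. -/
theorem eulerD_partialD {d : ℕ} (A : Matrix (Fin d) (Fin n) ℤ) {β : Fin d → ℂ} {i : Fin d}
    (hf : AnalyticAt ℂ f p) (h : eulerD A β i f =ᶠ[𝓝 p] 0) (j : Fin n) :
    eulerD A (fun i => β i - A i j) i (partialD j f) =ᶠ[𝓝 p] 0 := by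
  have hcomm : ∀ᶠ x in 𝓝 p, ∀ a, partialD j (partialD a f) x = partialD a (partialD j f) x :=
    Filter.eventually_all.2 fun a => partialD_comm hf j a
  filter_upwards [partialD_congr h j, hcomm, hf.eventually_analyticAt] with x hx hc hfx
  have hterm : ∀ a, HasFDerivAt (fun y : Fin n → ℂ => (A i a : ℂ) * y a * partialD a f y)
      (((A i a : ℂ) * x a) • fderiv ℂ (partialD a f) x +
        partialD a f x • ((A i a : ℂ) • ContinuousLinearMap.proj (R := ℂ) a)) x := fun a =>
    ((hasFDerivAt_apply a x).const_mul (A i a : ℂ)).mul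
      (analyticAt_partialD hfx a).differentiableAt.hasFDerivAt
  have hsum := (HasFDerivAt.fun_sum (u := Finset.univ) fun a _ => hterm a).sub
    (hfx.differentiableAt.hasFDerivAt.const_mul (β i))
  have h0 : partialD j (0 : (Fin n → ℂ) → ℂ) x = 0 := by simp [partialD]
  rw [h0] at hx
  have h1 : partialD j (eulerD A β i f) x = _ := congrArg (fun L => L (Pi.single j 1)) hsum.fderiv
  rw [h1] at hx
  simp only [sub_apply, sum_apply,
    add_apply, smul_apply, ContinuousLinearMap.proj_apply,
    smul_eq_mul, Finset.sum_add_distrib, Pi.single_apply, mul_ite, mul_one, mul_zero,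
    Finset.sum_ite_eq', Finset.mem_univ, if_true] at hx
  simp only [eulerD, Pi.zero_apply, ← hc]
  simp only [partialD] at hx ⊢
  linear_combination hx

theorem eulerD_monomialD {d : ℕ} (A : Matrix (Fin d) (Fin n) ℤ) {β : Fin d → ℂ} {i : Fin d}
    (hf : AnalyticAt ℂ f p) (h : eulerD A β i f =ᶠ[𝓝 p] 0) (u : Fin n →₀ ℕ) :
    eulerD A (fun i => β i - ∑ j, A i j * u j) i (monomialD u f) =ᶠ[𝓝 p] 0 := by
  induction u using induction_add_single with
  | zero => simpa [monomialD_zero] using h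
  | add_single u j ih =>
    have h1 := eulerD_partialD A (analyticAt_monomialD hf u) ih j
    have h2 := monomialD_add_single hf u j
    have h3 : ∀ᶠ x in 𝓝 p, ∀ a, partialD a (monomialD (u + Finsupp.single j 1) f) x =
        partialD a (partialD j (monomialD u f)) x :=
      Filter.eventually_all.2 fun a => partialD_congr h2 a
    filter_upwards [h1, h2, h3] with x h1 h2 h3
    rw [← h1]
    simp only [eulerD, h2, h3]
    congr 2
    simp [Finsupp.single_apply, mul_add, Finset.sum_add_distrib, sub_sub]

/-- An analytic function all of whose iterated partial derivatives vanish at a point vanishes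
near that point. -/
theorem eventuallyEq_zero_of_monomialD (hf : AnalyticAt ℂ f p) (h : ∀ u, monomialD u f p = 0) :
    f =ᶠ[𝓝 p] 0 := by
  -- The statement is for all `u` at once: on basis vectors the derivative of order `r + 1` of `∂^u
  -- f` is one of order `r` of `∂^(u + eⱼ) f`.
  have key : ∀ r (u : Fin n →₀ ℕ), iteratedFDeriv ℂ r (monomialD u f) p = 0 := by
    intro r
    induction r with
    | zero => intro u; ext v; simp [h u]
    | succ r ih =>
      intro u
      have hu := analyticAt_monomialD hf u
      apply ContinuousMultilinearMap.toMultilinearMap_injective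
      refine Module.Basis.ext_multilinear (fun _ => Pi.basisFun ℂ (Fin n)) fun w => ?_
      simp only [ContinuousMultilinearMap.coe_coe, Pi.basisFun_apply]
      rw [iteratedFDeriv_succ_apply_right]
      have h1 := ih (u + Finsupp.single (w (Fin.last r)) 1)
      rw [Filter.EventuallyEq.eq_of_nhds
        ((monomialD_add_single hf u (w (Fin.last r))).iteratedFDeriv (𝕜 := ℂ) r)] at h1
      have h2 := ContinuousLinearMap.iteratedFDeriv_comp_left (i := r) (n := ⊤)
        (ContinuousLinearMap.apply ℂ ℂ (Pi.single (w (Fin.last r)) (1 : ℂ) : Fin n → ℂ))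
        hu.fderiv.contDiffAt (by simp)
      have h3 : iteratedFDeriv ℂ r (partialD (w (Fin.last r)) (monomialD u f)) p = _ := h2
      rw [h1] at h3
      have h4 := congrArg
        (fun L => L (fun j : Fin r => (Pi.single (w (Fin.castSucc j)) 1 : Fin n → ℂ))) h3
      exact (by simpa using h4.symm : _ = (0 : ℂ))
  obtain ⟨q, hq⟩ := hf
  obtain ⟨ρ, hq⟩ := hq
  filter_upwards [Metric.eball_mem_nhds p hq.r_pos] with y hy
  have hs := hq.hasSum_sub hy
  have hz : ∀ r, q r (fun _ => y - p) = 0 := by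
    intro r
    have h1 := hq.factorial_smul (y - p) r
    have h2 := key r 0
    rw [monomialD_zero] at h2
    rw [h2] at h1
    simpa [Nat.factorial_ne_zero] using h1
  simp only [hz] at hs
  exact hs.unique hasSum_zero

end Derivatives

/-! ### Bounding the rank at `(1, 0, …, 0, 1)` and locating the rank jumps. -/

section RankBound

variable {m : ℕ} {k : Fin (m + 2) → ℕ}

/-- The second coordinate `∑ⱼ kⱼ uⱼ` of the degree `A u` of `∂^u`. -/
def lowerDegree (k : Fin (m + 2) → ℕ) (u : Fin (m + 2) →₀ ℕ) : ℕ := ∑ j, k j * u j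

/-- For `A u = (s₁, s₂)`, the number `kₙ s₁ - s₂ = ∑ⱼ (kₙ - kⱼ) uⱼ`. -/
def upperDegree (k : Fin (m + 2) → ℕ) (u : Fin (m + 2) →₀ ℕ) : ℕ :=
  ∑ j, (k (Fin.last (m + 1)) - k j) * u j

theorem upperDegree_add_lowerDegree (hk : StrictMono k) (u : Fin (m + 2) →₀ ℕ) :
    upperDegree k u + lowerDegree k u = k (Fin.last (m + 1)) * ∑ j, u j := by
  simp only [upperDegree, lowerDegree, ← Finset.sum_add_distrib, Finset.mul_sum, ← add_mul]
  exact Finset.sum_congr rfl fun j _ => by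
    rw [Nat.sub_add_cancel (hk.monotone (Fin.le_last j))]

theorem lowerDegree_add_single (u : Fin (m + 2) →₀ ℕ) (i : Fin (m + 2)) (a : ℕ) :
    lowerDegree k (u + Finsupp.single i a) = lowerDegree k u + k i * a := by
  simp [lowerDegree, mul_add, Finset.sum_add_distrib, Finsupp.single_apply]

theorem upperDegree_add_single (u : Fin (m + 2) →₀ ℕ) (i : Fin (m + 2)) (a : ℕ) :
    upperDegree k (u + Finsupp.single i a) =
      upperDegree k u + (k (Fin.last (m + 1)) - k i) * a := by
  simp [upperDegree, mul_add, Finset.sum_add_distrib, Finsupp.single_apply]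

theorem last_pos (hk : StrictMono k) : 0 < k (Fin.last (m + 1)) :=
  (Nat.zero_le _).trans_lt (hk (Fin.last_pos))

theorem mulVec_eq_of_degrees (hk : StrictMono k) {u w : Fin (m + 2) →₀ ℕ}
    (hx : upperDegree k u = upperDegree k w) (hy : lowerDegree k u = lowerDegree k w) :
    (curveMatrix k).mulVec (fun j => (u j : ℤ)) = (curveMatrix k).mulVec (fun j => (w j : ℤ)) := by
  have h := (upperDegree_add_lowerDegree hk u).symm.trans
    ((congrArg₂ (· + ·) hx hy).trans (upperDegree_add_lowerDegree hk w))
  have h' := Nat.eq_of_mul_eq_mul_left (last_pos hk) h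
  funext i
  fin_cases i
  · simp only [curveMatrix, Matrix.mulVec, dotProduct]
    simpa using congrArg (Nat.cast : ℕ → ℤ) h'
  · simp only [curveMatrix, Matrix.mulVec, dotProduct]
    simpa [lowerDegree] using congrArg (Nat.cast : ℕ → ℤ) hy

/-- The point `(1, 0, …, 0, 1)`. -/
def basePoint (m : ℕ) : Fin (m + 2) → ℂ := fun i => if i = 0 ∨ i = Fin.last (m + 1) then 1 else 0

theorem sum_mul_basePoint (g : Fin (m + 2) → ℂ) :
    ∑ i, g i * basePoint m i = g 0 + g (Fin.last (m + 1)) := by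
  have h : ∀ i, g i * basePoint m i =
      (if i = 0 then g 0 else 0) + if i = Fin.last (m + 1) then g (Fin.last (m + 1)) else 0 := by
    intro i
    by_cases h0 : i = 0
    · subst h0
      simp [basePoint, (Fin.last_pos (n := m)).ne]
    · by_cases h1 : i = Fin.last (m + 1)
      · subst h1; simp [basePoint]
      · simp [basePoint, h0, h1]
  simp [h, Finset.sum_add_distrib]

theorem basePoint_mem_nonsingularLocus (hk : StrictMono k) (hk0 : k 0 = 0) :
    basePoint m ∈ nonsingularLocus k := by
  refine ⟨by simp [basePoint], by simp [basePoint], ?_⟩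
  rintro ⟨z, hz, h0, h1⟩
  have hp : curvePolynomial k (basePoint m) = 1 + Polynomial.X ^ k (Fin.last (m + 1)) := by
    have h : ∀ i, Polynomial.C (basePoint m i) * Polynomial.X ^ k i =
        (if i = 0 then (1 : Polynomial ℂ) else 0) +
          if i = Fin.last (m + 1) then Polynomial.X ^ k (Fin.last (m + 1)) else 0 := by
      intro i
      by_cases h0 : i = 0
      · subst h0
        simp [basePoint, hk0, (Fin.last_pos (n := m)).ne]
      · by_cases h1 : i = Fin.last (m + 1)
        · subst h1; simp [basePoint]
        · simp [basePoint, h0, h1]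
    simp [curvePolynomial, h, Finset.sum_add_distrib]
  rw [hp] at h1
  simp [Polynomial.IsRoot, Polynomial.derivative_X_pow, hz, (last_pos hk).ne'] at h1

variable {β : Fin 2 → ℂ} {f : (Fin (m + 2) → ℂ) → ℂ}

theorem monomialD_eq_of_degrees (hk : StrictMono k) {p : Fin (m + 2) → ℂ}
    (hf : IsSolutionAt (curveMatrix k) β p f) {u w : Fin (m + 2) →₀ ℕ}
    (hx : upperDegree k u = upperDegree k w) (hy : lowerDegree k u = lowerDegree k w) :
    monomialD u f p = monomialD w f p := by
  by_cases huw : u = w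
  · rw [huw]
  have h := (hf.toric (MvPolynomial.monomial u 1 - MvPolynomial.monomial w 1)
    (Ideal.subset_span ⟨u, w, mulVec_eq_of_degrees hk hx hy, rfl⟩)).eq_of_nhds
  have hsupp : (MvPolynomial.monomial u (1 : ℂ) - MvPolynomial.monomial w 1).support ⊆ {u, w} := by
    refine (MvPolynomial.support_sub _ _ _).trans (Finset.union_subset ?_ ?_)
    · exact MvPolynomial.support_monomial_subset.trans (by simp)
    · exact MvPolynomial.support_monomial_subset.trans (by simp)
  have h2 : polyD (MvPolynomial.monomial u 1 - MvPolynomial.monomial w 1) f p =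
      ∑ v ∈ {u, w}, (MvPolynomial.monomial u (1 : ℂ) - MvPolynomial.monomial w 1).coeff v *
        monomialD v f p := by
    refine Finset.sum_subset hsupp fun v _ hv => ?_
    rw [MvPolynomial.notMem_support_iff.1 hv, zero_mul]
  rw [h2, Finset.sum_pair huw] at h
  simp only [MvPolynomial.coeff_sub, MvPolynomial.coeff_monomial, if_true, if_neg huw,
    if_neg (Ne.symm huw), Pi.zero_apply] at h
  linear_combination h

/-- All middle coordinates of the point vanish, so only the first and last terms of the Euler
operator survive. -/
theorem eulerD_basePoint (hf : IsSolutionAt (curveMatrix k) β (basePoint m) f) (i : Fin 2)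
    (u : Fin (m + 2) →₀ ℕ) :
    (curveMatrix k i 0 : ℂ) * monomialD (u + Finsupp.single 0 1) f (basePoint m) +
      (curveMatrix k i (Fin.last (m + 1)) : ℂ) *
        monomialD (u + Finsupp.single (Fin.last (m + 1)) 1) f (basePoint m) =
      (β i - ∑ j, (curveMatrix k i j : ℂ) * u j) * monomialD u f (basePoint m) := by
  have h := (eulerD_monomialD (curveMatrix k) hf.analyticAt (hf.euler i) u).eq_of_nhds
  have h2 := sum_mul_basePoint fun j =>
    (curveMatrix k i j : ℂ) * partialD j (monomialD u f) (basePoint m)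
  simp only [eulerD, Pi.zero_apply] at h
  rw [(monomialD_add_single hf.analyticAt u _).eq_of_nhds,
    (monomialD_add_single hf.analyticAt u _).eq_of_nhds, ← h2, ← sub_eq_zero, ← h]
  push_cast
  congr 1
  exact Finset.sum_congr rfl fun j _ => by ring

theorem monomialD_add_single_last (hk0 : k 0 = 0)
    (hf : IsSolutionAt (curveMatrix k) β (basePoint m) f) (u : Fin (m + 2) →₀ ℕ) :
    (k (Fin.last (m + 1)) : ℂ) *
        monomialD (u + Finsupp.single (Fin.last (m + 1)) 1) f (basePoint m) =
      (β 1 - lowerDegree k u) * monomialD u f (basePoint m) := by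
  have h := eulerD_basePoint hf 1 u
  simpa [curveMatrix, hk0, lowerDegree] using h

/-- `K` times the first Euler relation minus the second eliminates the derivative in the last
direction. -/
theorem monomialD_add_single_zero (hk : StrictMono k) (hk0 : k 0 = 0)
    (hf : IsSolutionAt (curveMatrix k) β (basePoint m) f) (u : Fin (m + 2) →₀ ℕ) :
    (k (Fin.last (m + 1)) : ℂ) * monomialD (u + Finsupp.single 0 1) f (basePoint m) =
      (k (Fin.last (m + 1)) * β 0 - β 1 - upperDegree k u) * monomialD u f (basePoint m) := by
  have h := eulerD_basePoint hf 0 u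
  have h1 := monomialD_add_single_last hk0 hf u
  have h2 := congrArg (Nat.cast : ℕ → ℂ) (upperDegree_add_lowerDegree hk u)
  simp only [curveMatrix, Matrix.of_apply, Matrix.cons_val_zero, Int.cast_one, one_mul] at h
  push_cast at h2
  linear_combination (k (Fin.last (m + 1)) : ℂ) * h - h1 + monomialD u f (basePoint m) * h2

/-- A function of the exponents which satisfies the relations between the values at `basePoint` of
the derivatives of a solution is determined on a coset of `ℤ a₁ + ℤ aₙ` by a single value. -/
theorem eq_zero_of_eq_zero_base (hk : StrictMono k) (hk0 : k 0 = 0) {b b' : ℂ}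
    {c : (Fin (m + 2) →₀ ℕ) → ℂ}
    (hc : ∀ u w, upperDegree k u = upperDegree k w → lowerDegree k u = lowerDegree k w → c u = c w)
    (hlast : ∀ u, (k (Fin.last (m + 1)) : ℂ) * c (u + Finsupp.single (Fin.last (m + 1)) 1) =
      (b - lowerDegree k u) * c u)
    (hzero : ∀ u, (k (Fin.last (m + 1)) : ℂ) * c (u + Finsupp.single 0 1) =
      (b' - upperDegree k u) * c u)
    {u₀ : Fin (m + 2) →₀ ℕ}
    (hy : ∀ w, lowerDegree k w ≡ lowerDegree k u₀ [MOD k (Fin.last (m + 1))] →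
      b = lowerDegree k w → lowerDegree k w = lowerDegree k u₀)
    (hx : ∀ w, lowerDegree k w ≡ lowerDegree k u₀ [MOD k (Fin.last (m + 1))] →
      b' = upperDegree k w → upperDegree k w = upperDegree k u₀)
    (h₀ : c u₀ = 0) {u : Fin (m + 2) →₀ ℕ}
    (hu : lowerDegree k u ≡ lowerDegree k u₀ [MOD k (Fin.last (m + 1))]) : c u = 0 := by
  set K := k (Fin.last (m + 1)) with hK
  have hK0 : (K : ℂ) ≠ 0 := by exact_mod_cast (last_pos hk).ne'
  have up_last : ∀ w r, c w = 0 → c (w + Finsupp.single (Fin.last (m + 1)) r) = 0 := by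
    intro w r h
    induction r with
    | zero => simpa using h
    | succ r ih =>
      have := hlast (w + Finsupp.single (Fin.last (m + 1)) r)
      rw [ih, mul_zero, add_assoc, ← Finsupp.single_add] at this
      exact (mul_eq_zero.1 this).resolve_left hK0
  have up_zero : ∀ w r, c w = 0 → c (w + Finsupp.single 0 r) = 0 := by
    intro w r h
    induction r with
    | zero => simpa using h
    | succ r ih =>
      have := hzero (w + Finsupp.single 0 r)
      rw [ih, mul_zero, add_assoc, ← Finsupp.single_add] at this
      exact (mul_eq_zero.1 this).resolve_left hK0
  have down_last : ∀ w r, (∀ j < r, b ≠ (lowerDegree k w + K * j : ℕ)) →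
      c (w + Finsupp.single (Fin.last (m + 1)) r) = 0 → c w = 0 := by
    intro w r hj h
    induction r with
    | zero => simpa using h
    | succ r ih =>
      refine ih (fun j hjr => hj j (by omega)) ?_
      have := hlast (w + Finsupp.single (Fin.last (m + 1)) r)
      rw [add_assoc, ← Finsupp.single_add, h, mul_zero, lowerDegree_add_single] at this
      exact (mul_eq_zero.1 this.symm).resolve_left (sub_ne_zero.2 (hj r (by omega)))
  have down_zero : ∀ w r, (∀ j < r, b' ≠ (upperDegree k w + K * j : ℕ)) →
      c (w + Finsupp.single 0 r) = 0 → c w = 0 := by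
    intro w r hj h
    induction r with
    | zero => simpa using h
    | succ r ih =>
      refine ih (fun j hjr => hj j (by omega)) ?_
      have := hzero (w + Finsupp.single 0 r)
      rw [add_assoc, ← Finsupp.single_add, h, mul_zero, upperDegree_add_single, hk0,
        Nat.sub_zero] at this
      exact (mul_eq_zero.1 this.symm).resolve_left (sub_ne_zero.2 (hj r (by omega)))
  -- The sum of the two degrees is divisible by `K`, so a congruence of lower degrees gives one of
  -- upper degrees.
  have hu' : upperDegree k u ≡ upperDegree k u₀ [MOD K] := by
    refine Nat.ModEq.add_right_cancel hu ?_
    rw [upperDegree_add_lowerDegree hk, upperDegree_add_lowerDegree hk]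
    exact (Nat.modEq_zero_iff_dvd.2 ⟨_, rfl⟩).trans (Nat.modEq_zero_iff_dvd.2 ⟨_, rfl⟩).symm
  have balance : ∀ s t : ℕ, s ≡ t [MOD K] →
      ∃ r r', s + K * r = t + K * r' ∧ (r' = 0 ∨ r = 0) := by
    intro s t h
    rcases le_total s t with hst | hst
    · obtain ⟨r, hr⟩ := (Nat.modEq_iff_dvd' hst).1 h
      exact ⟨r, 0, by omega, Or.inl rfl⟩
    · obtain ⟨r, hr⟩ := (Nat.modEq_iff_dvd' hst).1 h.symm
      exact ⟨0, r, by omega, Or.inr rfl⟩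
  obtain ⟨r, r', hr, hrr⟩ := balance _ _ hu
  obtain ⟨q, q', hq, hqq⟩ := balance _ _ hu'
  have hmod : ∀ (w : Fin (m + 2) →₀ ℕ) j,
      lowerDegree k (w + Finsupp.single (Fin.last (m + 1)) j) ≡ lowerDegree k w [MOD K] := by
    intro w j
    rw [lowerDegree_add_single]
    simp [Nat.ModEq, hK]
  have hmod0 : ∀ (w : Fin (m + 2) →₀ ℕ) j,
      lowerDegree k (w + Finsupp.single 0 j) = lowerDegree k w := by
    intro w j
    rw [lowerDegree_add_single, hk0, zero_mul, add_zero]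
  -- Climb from `u₀`, where multiplication by the factors preserves zero, to a degree common with
  -- `u`, then descend to `u` by dividing. In each direction either the climb or the descent is
  -- empty. A zero factor on the descent would, by `hx` or `hy`, sit at the coordinate of `u₀`; but
  -- the descent stays strictly below that.
  refine down_zero u q ?_ (down_last _ r ?_ ?_)
  · intro j hj hb
    have h1 := hx (u + Finsupp.single 0 j) (by rw [hmod0]; exact hu)
      (by rw [hb, upperDegree_add_single, hk0, Nat.sub_zero])
    rw [upperDegree_add_single, hk0, Nat.sub_zero, ← hK] at h1
    have hq' : q' = 0 := by omega
    subst hq'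
    have : K * j < K * q := Nat.mul_lt_mul_of_pos_left hj (last_pos hk)
    omega
  · intro j hj hb
    rw [hmod0] at hb
    have h1 := hy (u + Finsupp.single (Fin.last (m + 1)) j) ((hmod u j).trans hu)
      (by rw [hb, lowerDegree_add_single])
    rw [lowerDegree_add_single, ← hK] at h1
    have hr' : r' = 0 := by omega
    subst hr'
    have : K * j < K * r := Nat.mul_lt_mul_of_pos_left hj (last_pos hk)
    omega
  · rw [hc _ (u₀ + Finsupp.single 0 q' + Finsupp.single (Fin.last (m + 1)) r')]
    · exact up_last _ _ (up_zero _ _ h₀)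
    · simp only [upperDegree_add_single, hk0, Nat.sub_zero, Nat.sub_self, ← hK]
      omega
    · simp only [lowerDegree_add_single, hk0, ← hK]
      omega

/-- The value at `p` of the derivative `∂^u` of a germ of a solution. -/
noncomputable def derivValue {d n : ℕ} (A : Matrix (Fin d) (Fin n) ℤ) (β : Fin d → ℂ)
    (p : Fin n → ℂ) (φ : solutionGerms A β p) (u : Fin n →₀ ℕ) : ℂ :=
  monomialD u (Classical.choose φ.2) p

theorem derivValue_eq {d n : ℕ} {A : Matrix (Fin d) (Fin n) ℤ} {β : Fin d → ℂ}
    {p : Fin n → ℂ} {φ : solutionGerms A β p} {f : (Fin n → ℂ) → ℂ}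
    (h : (φ : (𝓝 p).Germ ℂ) = (f : (𝓝 p).Germ ℂ)) (u : Fin n →₀ ℕ) :
    derivValue A β p φ u = monomialD u f p := by
  have h1 := (Classical.choose_spec φ.2).2
  have h2 : Classical.choose φ.2 =ᶠ[𝓝 p] f := Filter.Germ.coe_eq.1 (h1.symm.trans h)
  suffices h3 : monomialD u (Classical.choose φ.2) =ᶠ[𝓝 p] monomialD u f from h3.eq_of_nhds
  unfold monomialD
  induction List.finRange n with
  | nil => exact h2
  | cons i l ih => exact iterate_partialD_congr ih i _

/-- If every nonempty coset has a base point then the rank is at most `kₙ`. -/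
theorem rank_solutionGerms_le (hk : StrictMono k) (hk0 : k 0 = 0)
    (hbase : ∀ r, (∃ u, lowerDegree k u ≡ r [MOD k (Fin.last (m + 1))]) →
      ∃ u₀, lowerDegree k u₀ ≡ r [MOD k (Fin.last (m + 1))] ∧
        (∀ w, lowerDegree k w ≡ r [MOD k (Fin.last (m + 1))] →
          β 1 = lowerDegree k w → lowerDegree k w = lowerDegree k u₀) ∧
        (∀ w, lowerDegree k w ≡ r [MOD k (Fin.last (m + 1))] →
          k (Fin.last (m + 1)) * β 0 - β 1 = upperDegree k w →
          upperDegree k w = upperDegree k u₀)) :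
    Module.rank ℂ (solutionGerms (curveMatrix k) β (basePoint m)) ≤
      (k (Fin.last (m + 1)) : Cardinal) := by
  -- A base point is chosen for every residue; `0` is a dummy for residues that no degree attains.
  have hch : ∀ r, ∃ u₀, (∃ u, lowerDegree k u ≡ r [MOD k (Fin.last (m + 1))]) →
      lowerDegree k u₀ ≡ r [MOD k (Fin.last (m + 1))] ∧
        (∀ w, lowerDegree k w ≡ r [MOD k (Fin.last (m + 1))] →
          β 1 = lowerDegree k w → lowerDegree k w = lowerDegree k u₀) ∧
        (∀ w, lowerDegree k w ≡ r [MOD k (Fin.last (m + 1))] →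
          k (Fin.last (m + 1)) * β 0 - β 1 = upperDegree k w →
          upperDegree k w = upperDegree k u₀) := by
    intro r
    by_cases h : ∃ u, lowerDegree k u ≡ r [MOD k (Fin.last (m + 1))]
    · obtain ⟨u₀, h₀⟩ := hbase r h
      exact ⟨u₀, fun _ => h₀⟩
    · exact ⟨0, fun h' => absurd h' h⟩
  choose ub hub using hch
  -- One Taylor derivative per residue mod `K`; injectivity of this map is the rank bound.
  let Φ : solutionGerms (curveMatrix k) β (basePoint m) →ₗ[ℂ] (Fin (k (Fin.last (m + 1))) → ℂ) :=
    { toFun := fun φ r => derivValue _ _ _ φ (ub r)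
      map_add' := by
        rintro ⟨_, f, hf, rfl⟩ ⟨_, g, hg, rfl⟩
        funext r
        have h := (monomialD_spec hf.analyticAt hg.analyticAt 1 (ub r) (List.finRange _)).2.2
        rw [Pi.add_apply, derivValue_eq (φ := ⟨_, f, hf, rfl⟩) (f := f) rfl,
          derivValue_eq (φ := ⟨_, g, hg, rfl⟩) (f := g) rfl,
          derivValue_eq (f := fun x => f x + 1 * g x) (by simp only [one_mul]; rfl)]
        simpa [monomialD] using h.eq_of_nhds
      map_smul' := by
        rintro c ⟨_, f, hf, rfl⟩
        funext r
        have h := (monomialD_spec (isSolutionAt_zero (curveMatrix k) β).analyticAt hf.analyticAt c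
          (ub r) (List.finRange _)).2.2
        -- Applied to `0 + (-1) * 0`, additivity says that the derivative of the zero function
        -- vanishes.
        have h0 := (monomialD_spec (isSolutionAt_zero (curveMatrix k) β).analyticAt
          (isSolutionAt_zero (curveMatrix k) β (p := basePoint m)).analyticAt (-1) (ub r)
          (List.finRange _)).2.2.eq_of_nhds
        rw [Pi.smul_apply, derivValue_eq (φ := ⟨_, f, hf, rfl⟩) (f := f) rfl,
          derivValue_eq (f := fun x => 0 + c * f x) (by simp only [zero_add]; rfl)]
        have h1 := h.eq_of_nhds
        simp only [mul_zero, add_zero] at h0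
        simp only [RingHom.id_apply, smul_eq_mul]
        unfold monomialD
        rw [h1]
        linear_combination h0 }
  have hinj : Function.Injective Φ := by
    rw [← LinearMap.ker_eq_bot, LinearMap.ker_eq_bot']
    rintro ⟨_, f, hf, rfl⟩ hφ
    have hval : ∀ r : Fin (k (Fin.last (m + 1))), monomialD (ub r) f (basePoint m) = 0 := by
      intro r
      have := congrFun hφ r
      rwa [← derivValue_eq (φ := ⟨_, f, hf, rfl⟩) rfl]
    have hall : ∀ u, monomialD u f (basePoint m) = 0 := by
      intro u
      have hlt := Nat.mod_lt (lowerDegree k u) (last_pos hk)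
      have hmod := (Nat.mod_modEq (lowerDegree k u) (k (Fin.last (m + 1)))).symm
      obtain ⟨h1, h2, h3⟩ := hub _ ⟨u, hmod⟩
      exact eq_zero_of_eq_zero_base (c := fun u => monomialD u f (basePoint m)) hk hk0
        (fun _ _ => monomialD_eq_of_degrees hk hf) (monomialD_add_single_last hk0 hf)
        (monomialD_add_single_zero hk hk0 hf)
        (fun w hw => h2 w (hw.trans h1)) (fun w hw => h3 w (hw.trans h1))
        (hval ⟨_, hlt⟩) (hmod.trans h1.symm)
    exact Subtype.ext (Filter.Germ.coe_eq.2 (eventuallyEq_zero_of_monomialD hf.analyticAt hall))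
  simpa using LinearMap.rank_le_of_injective Φ hinj

/-- A rank-jumping parameter lies in `((ℕA + ℤa₁) ∩ (ℕA + ℤaₙ)) ∖ ℕA`. -/
theorem exists_of_mem_rankJumping (hk : StrictMono k) (hk0 : k 0 = 0) (hβ : β ∈ rankJumping k) :
    ∃ u w, lowerDegree k u ≡ lowerDegree k w [MOD k (Fin.last (m + 1))] ∧
      β 1 = lowerDegree k u ∧ k (Fin.last (m + 1)) * β 0 - β 1 = upperDegree k w ∧
      ¬ ∃ v, lowerDegree k v = lowerDegree k u ∧ upperDegree k v = upperDegree k w := by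
  by_contra! hcon
  refine (hβ _ (basePoint_mem_nonsingularLocus hk hk0)).not_ge (rank_solutionGerms_le hk hk0 ?_)
  rintro r ⟨s, hs⟩
  -- The base point is placed where the factors vanish: at a common zero when both vanish on the
  -- coset (it exists because `β` is assumed not to be a hole), at a zero of the only one that does,
  -- or anywhere.
  by_cases hy : ∃ u, lowerDegree k u ≡ r [MOD k (Fin.last (m + 1))] ∧ β 1 = lowerDegree k u
  · obtain ⟨u, hu, hu'⟩ := hy
    by_cases hx : ∃ w, lowerDegree k w ≡ r [MOD k (Fin.last (m + 1))] ∧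
        k (Fin.last (m + 1)) * β 0 - β 1 = upperDegree k w
    · obtain ⟨w, hw, hw'⟩ := hx
      obtain ⟨v, hv, hv'⟩ := hcon u w (hu.trans hw.symm) hu' hw'
      refine ⟨v, hv ▸ hu, fun t _ ht => ?_, fun t _ ht => ?_⟩
      · rw [hv]; exact_mod_cast ht.symm.trans hu'
      · rw [hv']; exact_mod_cast ht.symm.trans hw'
    · refine ⟨u, hu, fun t _ ht => ?_, fun t ht ht' => absurd ⟨t, ht, ht'⟩ hx⟩
      exact_mod_cast ht.symm.trans hu'
  · by_cases hx : ∃ w, lowerDegree k w ≡ r [MOD k (Fin.last (m + 1))] ∧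
        k (Fin.last (m + 1)) * β 0 - β 1 = upperDegree k w
    · obtain ⟨w, hw, hw'⟩ := hx
      refine ⟨w, hw, fun t ht ht' => absurd ⟨t, ht, ht'⟩ hy, fun t _ ht => ?_⟩
      exact_mod_cast ht.symm.trans hw'
    · exact ⟨s, hs, fun t ht ht' => absurd ⟨t, ht, ht'⟩ hy,
        fun t ht ht' => absurd ⟨t, ht, ht'⟩ hx⟩

end RankBound

/-! ### The Ishida complex in the degree of a hole. -/

section Cohomology

variable {m : ℕ} {k : Fin (m + 2) → ℕ}

/-- The class of `∂^u` in `ℂ[∂]/I_A`. -/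
noncomputable def delMonomial (k : Fin (m + 2) → ℕ) (u : Fin (m + 2) → ℕ) : ToricRing k :=
  ∏ i, del k i ^ u i

theorem mk_monomial (u : Fin (m + 2) →₀ ℕ) :
    (Ideal.Quotient.mk (toricIdeal (curveMatrix k)) (MvPolynomial.monomial u 1) : ToricRing k) =
      delMonomial k u := by
  rw [MvPolynomial.monomial_eq, map_one, one_mul, Finsupp.prod_fintype _ _ (by simp), map_prod]
  simp only [map_pow]
  rfl

theorem delMonomial_eq_of_mulVec_eq {u w : Fin (m + 2) → ℕ}
    (h : (curveMatrix k).mulVec (fun j => (u j : ℤ)) = (curveMatrix k).mulVec fun j => (w j : ℤ)) :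
    delMonomial k u = delMonomial k w := by
  have h1 := mk_monomial (k := k) (Finsupp.equivFunOnFinite.symm u)
  have h2 := mk_monomial (k := k) (Finsupp.equivFunOnFinite.symm w)
  simp only [Finsupp.coe_equivFunOnFinite_symm] at h1 h2
  rw [← h1, ← h2]
  refine Ideal.Quotient.eq.2 (Ideal.subset_span ⟨_, _, ?_, rfl⟩)
  simpa using h

theorem delMonomial_add_single (u : Fin (m + 2) → ℕ) (b : Fin (m + 2)) (r : ℕ) :
    delMonomial k (u + Pi.single b r) = delMonomial k u * del k b ^ r := by
  simp only [delMonomial, Pi.add_apply, pow_add, Finset.prod_mul_distrib]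
  congr 1
  rw [Finset.prod_eq_single b]
  · simp
  · intro i _ hi; simp [hi]
  · simp

theorem aeval_monomial_single (u : Fin (m + 2) →₀ ℕ) (c : ℂ) :
    MvPolynomial.aeval (fun i => AddMonoidAlgebra.single (fun r => curveMatrix k r i) (1 : ℂ))
      (MvPolynomial.monomial u c) =
      AddMonoidAlgebra.single ((curveMatrix k).mulVec fun j => (u j : ℤ)) c := by
  have h : ∀ s : Finset (Fin (m + 2)),
      ∏ i ∈ s, AddMonoidAlgebra.single (fun r => curveMatrix k r i) (1 : ℂ) ^ u i =
        AddMonoidAlgebra.single (∑ i ∈ s, u i • fun r => curveMatrix k r i) 1 := by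
    intro s
    induction s using Finset.induction_on with
    | empty => rfl
    | insert i s hi ih =>
      rw [Finset.prod_insert hi, Finset.sum_insert hi, ih, AddMonoidAlgebra.single_pow,
        AddMonoidAlgebra.single_mul_single, one_pow, one_mul]
  rw [MvPolynomial.aeval_monomial, Finsupp.prod_fintype _ _ (by simp), h,
    Algebra.algebraMap_eq_smul_one, smul_mul_assoc, one_mul, AddMonoidAlgebra.smul_single,
    smul_eq_mul, mul_one]
  congr 1
  funext r
  simp [Matrix.mulVec, dotProduct, Finset.sum_apply, mul_comm]

/-- The homomorphism `ℂ[∂]/I_A → ℂ[ℤ²]` that sends `∂ᵢ` to the monomial of degree `aᵢ`. -/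
noncomputable def toLaurent (k : Fin (m + 2) → ℕ) :
    ToricRing k →+* AddMonoidAlgebra ℂ (Fin 2 → ℤ) :=
  Ideal.Quotient.lift (toricIdeal (curveMatrix k))
    (MvPolynomial.aeval fun i => AddMonoidAlgebra.single (fun r => curveMatrix k r i) (1 : ℂ) :
      MvPolynomial (Fin (m + 2)) ℂ →ₐ[ℂ] AddMonoidAlgebra ℂ (Fin 2 → ℤ)).toRingHom (by
    suffices h : toricIdeal (curveMatrix k) ≤ RingHom.ker (MvPolynomial.aeval fun i =>
        AddMonoidAlgebra.single (fun r => curveMatrix k r i) (1 : ℂ)).toRingHom from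
      fun a ha => h ha
    refine Ideal.span_le.2 ?_
    rintro _ ⟨u, w, h, rfl⟩
    change MvPolynomial.aeval _ _ = _
    rw [map_sub, aeval_monomial_single, aeval_monomial_single, h, sub_self])

theorem toLaurent_mk_monomial (u : Fin (m + 2) →₀ ℕ) (c : ℂ) :
    toLaurent k (Ideal.Quotient.mk (toricIdeal (curveMatrix k)) (MvPolynomial.monomial u c)) =
      AddMonoidAlgebra.single ((curveMatrix k).mulVec fun j => (u j : ℤ)) c :=
  aeval_monomial_single u c

theorem toLaurent_delMonomial (u : Fin (m + 2) → ℕ) :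
    toLaurent k (delMonomial k u) =
      AddMonoidAlgebra.single ((curveMatrix k).mulVec fun j => (u j : ℤ)) 1 := by
  have h := toLaurent_mk_monomial (k := k) (Finsupp.equivFunOnFinite.symm u) 1
  rw [mk_monomial] at h
  simpa using h

/-- The image in `ℂ[ℤ²]` is supported on `ℕA`; this detects that a Laurent monomial does not come
from the toric ring. -/
theorem toLaurent_apply_eq_zero {α : Fin 2 → ℤ}
    (hα : ¬ ∃ u : Fin (m + 2) → ℕ, (curveMatrix k).mulVec (fun j => (u j : ℤ)) = α)
    (r : ToricRing k) : (toLaurent k r).coeff α = 0 := by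
  obtain ⟨P, rfl⟩ := Ideal.Quotient.mk_surjective r
  induction P using MvPolynomial.induction_on' with
  | monomial u c =>
    have h : (curveMatrix k).mulVec (fun j => (u j : ℤ)) ≠ α := fun h => hα ⟨u, h⟩
    rw [toLaurent_mk_monomial, AddMonoidAlgebra.coeff_single, Finsupp.single_eq_of_ne h.symm]
  | add P Q hP hQ =>
    rw [map_add]
    erw [map_add]
    rw [AddMonoidAlgebra.coeff_add, Finsupp.add_apply, hP, hQ, add_zero]

theorem coe_toNat_eq_add_single {b : Fin (m + 2)} {v : Fin (m + 2) → ℤ} (hv : ∀ i, i ≠ b → 0 ≤ v i) :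
    (fun i => ((v i).toNat : ℤ)) = v + Pi.single b ((-v b).toNat : ℤ) := by
  funext i
  by_cases hi : i = b
  · subst hi; simp only [Pi.add_apply, Pi.single_eq_same]; omega
  · have := hv i hi
    simp [hi, this]

theorem laurentMonomial_mul (b : Fin (m + 2)) (v : Fin (m + 2) → ℤ) :
    laurentMonomial k b v * algebraMap _ _ (del k b) ^ (-v b).toNat =
      algebraMap _ _ (delMonomial k fun i => (v i).toNat) := by
  rw [laurentMonomial, mul_assoc, ← mul_pow, mul_comm (IsLocalization.Away.invSelf _),
    IsLocalization.Away.mul_invSelf, one_pow, mul_one, delMonomial]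

/-- After denominators are cleared, both sides are ordinary monomials of equal degree. The general
target `T` covers both a single localization, with identity maps, and the comparison in the double
localization. -/
theorem map_laurentMonomial_eq {T : Type*} [CommRing T] [Algebra (ToricRing k) T]
    {b b' : Fin (m + 2)} (g : AwayDel k b →ₐ[ToricRing k] T) (g' : AwayDel k b' →ₐ[ToricRing k] T)
    (hb : IsUnit (algebraMap (ToricRing k) T (del k b)))
    (hb' : IsUnit (algebraMap (ToricRing k) T (del k b')))
    {v v' : Fin (m + 2) → ℤ} (hv : ∀ i, i ≠ b → 0 ≤ v i) (hv' : ∀ i, i ≠ b' → 0 ≤ v' i)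
    (h : (curveMatrix k).mulVec v = (curveMatrix k).mulVec v') :
    g (laurentMonomial k b v) = g' (laurentMonomial k b' v') := by
  have h1 := congrArg g (laurentMonomial_mul (k := k) b v)
  have h2 := congrArg g' (laurentMonomial_mul (k := k) b' v')
  simp only [map_mul, map_pow, AlgHom.commutes] at h1 h2
  refine ((hb.pow (-v b).toNat).mul (hb'.pow (-v' b').toNat)).mul_right_cancel ?_
  rw [← mul_assoc, h1, mul_comm (_ ^ _) (_ ^ _), ← mul_assoc, h2]
  simp only [← map_pow, ← map_mul, ← delMonomial_add_single]
  congr 1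
  apply delMonomial_eq_of_mulVec_eq
  have e : ∀ (b c : Fin (m + 2)) (v : Fin (m + 2) → ℤ) (r : ℕ), (∀ i, i ≠ b → 0 ≤ v i) →
      (fun j => (((fun i => (v i).toNat) + Pi.single c r : Fin (m + 2) → ℕ) j : ℤ)) =
        v + Pi.single b ((-v b).toNat : ℤ) + Pi.single c (r : ℤ) := by
    intro b c v r hv
    rw [← coe_toNat_eq_add_single hv]
    funext j
    by_cases hj : j = c
    · subst hj; simp
    · simp [hj]
  rw [e b _ v _ hv, e b' _ v' _ hv']
  simp only [Matrix.mulVec_add, h]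
  abel

theorem laurentMonomial_eq {b : Fin (m + 2)} {v w : Fin (m + 2) → ℤ} (hv : ∀ i, i ≠ b → 0 ≤ v i)
    (hw : ∀ i, i ≠ b → 0 ≤ w i) (h : (curveMatrix k).mulVec v = (curveMatrix k).mulVec w) :
    laurentMonomial k b v = laurentMonomial k b w :=
  have hu := IsLocalization.Away.algebraMap_isUnit (S := AwayDel k b) (del k b)
  map_laurentMonomial_eq (AlgHom.id _ _) (AlgHom.id _ _) hu hu hv hw h

theorem awayGraded_eq_span {b : Fin (m + 2)} {v : Fin (m + 2) → ℤ} (hv : ∀ i, i ≠ b → 0 ≤ v i) :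
    awayGraded k b ((curveMatrix k).mulVec v) = Submodule.span ℂ {laurentMonomial k b v} := by
  unfold awayGraded
  congr 1
  ext y
  constructor
  · rintro ⟨w, hw, hA, rfl⟩
    exact laurentMonomial_eq hw hv hA
  · rintro rfl
    exact ⟨v, hv, rfl, rfl⟩

theorem isUnit_toLaurent_del (b : Fin (m + 2)) : IsUnit (toLaurent k (del k b)) := by
  have h : toLaurent k (del k b) = AddMonoidAlgebra.single (fun r => curveMatrix k r b) 1 :=
    MvPolynomial.aeval_X _ b
  refine IsUnit.of_mul_eq_one (AddMonoidAlgebra.single (-fun r => curveMatrix k r b) 1) ?_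
  rw [h, AddMonoidAlgebra.single_mul_single, add_neg_cancel, mul_one]
  rfl

theorem map_laurentMonomial_toLaurent {b : Fin (m + 2)}
    (ψ : AwayDel k b →+* AddMonoidAlgebra ℂ (Fin 2 → ℤ))
    (hψ : ∀ r, ψ (algebraMap _ _ r) = toLaurent k r) {v : Fin (m + 2) → ℤ}
    (hv : ∀ i, i ≠ b → 0 ≤ v i) :
    ψ (laurentMonomial k b v) = AddMonoidAlgebra.single ((curveMatrix k).mulVec v) 1 := by
  have h := congrArg ψ (laurentMonomial_mul (k := k) b v)
  rw [map_mul, map_pow, hψ, hψ, toLaurent_delMonomial, coe_toNat_eq_add_single hv] at h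
  refine ((isUnit_toLaurent_del (k := k) b).pow (-v b).toNat).mul_right_cancel ?_
  rw [h, ← map_pow]
  have h1 := delMonomial_add_single (k := k) 0 b (-v b).toNat
  have h2 : delMonomial k 0 = 1 := by simp [delMonomial]
  rw [zero_add, h2, one_mul] at h1
  rw [← h1, toLaurent_delMonomial, AddMonoidAlgebra.single_mul_single, mul_one, ← Matrix.mulVec_add]
  congr 3
  funext j
  by_cases hj : j = b
  · subst hj; simp
  · simp [hj]

/-- In a degree outside `ℕA` that contains monomials of both localizations, these form a cocycle
whose class is a basis of the graded component of the first cohomology. -/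
theorem ishidaH1Graded_eq_span {α : Fin 2 → ℤ}
    (hα : ¬ ∃ u : Fin (m + 2) → ℕ, (curveMatrix k).mulVec (fun j => (u j : ℤ)) = α)
    {v v' : Fin (m + 2) → ℤ} (hv : ∀ i, i ≠ 0 → 0 ≤ v i)
    (hv' : ∀ i, i ≠ Fin.last (m + 1) → 0 ≤ v' i)
    (hvα : (curveMatrix k).mulVec v = α) (hvα' : (curveMatrix k).mulVec v' = α) :
    ∃ h : (laurentMonomial k 0 v, laurentMonomial k (Fin.last (m + 1)) v') ∈
        LinearMap.ker (ishidaD1 k),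
      ishidaClass k ⟨_, h⟩ ≠ 0 ∧
      ishidaH1Graded k α = Submodule.span ℂ {ishidaClass k ⟨_, h⟩} := by
  have hunit := IsLocalization.Away.algebraMap_isUnit (S := AwayBoth k)
    (del k 0 * del k (Fin.last (m + 1)))
  rw [map_mul, IsUnit.mul_iff] at hunit
  have heq : awayFirst k (laurentMonomial k 0 v) =
      awayLast k (laurentMonomial k (Fin.last (m + 1)) v') :=
    map_laurentMonomial_eq _ _ hunit.1 hunit.2 hv hv' (hvα.trans hvα'.symm)
  have hne : awayFirst k (laurentMonomial k 0 v) ≠ 0 := by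
    intro h0
    have hu : IsUnit (toLaurent k (del k 0 * del k (Fin.last (m + 1)))) := by
      rw [map_mul]; exact (isUnit_toLaurent_del _).mul (isUnit_toLaurent_del _)
    let ψ : AwayBoth k →+* AddMonoidAlgebra ℂ (Fin 2 → ℤ) := IsLocalization.Away.lift _ hu
    have h1 := map_laurentMonomial_toLaurent (ψ.comp (awayFirst k).toRingHom)
      (fun r => by
        change ψ (awayFirst k (algebraMap _ _ r)) = _
        rw [AlgHom.commutes]
        exact IsLocalization.Away.lift_eq _ hu r) hv
    have h2 : ψ (awayFirst k (laurentMonomial k 0 v)) = _ := h1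
    rw [h0, map_zero] at h2
    exact one_ne_zero (AddMonoidAlgebra.single_eq_zero.1 h2.symm)
  have hker : (laurentMonomial k 0 v, laurentMonomial k (Fin.last (m + 1)) v') ∈
      LinearMap.ker (ishidaD1 k) := by
    change awayLast k (laurentMonomial k (Fin.last (m + 1)) v') -
      awayFirst k (laurentMonomial k 0 v) = 0
    rw [heq, sub_self]
  refine ⟨hker, ?_, ?_⟩
  -- A preimage under `δ⁰` would be an element of the toric ring whose image in `ℂ[ℤ²]` has
  -- coefficient `1` at `α ∉ ℕA`.
  · intro h0
    have h1 := (Submodule.Quotient.mk_eq_zero _).1 h0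
    obtain ⟨r, hr⟩ := h1
    have hr0 : algebraMap _ (AwayDel k 0) r = laurentMonomial k 0 v := congrArg Prod.fst hr
    let ψ : AwayDel k 0 →+* AddMonoidAlgebra ℂ (Fin 2 → ℤ) :=
      IsLocalization.Away.lift _ (isUnit_toLaurent_del (k := k) 0)
    have hψ : ∀ r, ψ (algebraMap _ _ r) = toLaurent k r :=
      IsLocalization.Away.lift_eq _ (isUnit_toLaurent_del (k := k) 0)
    have h2 := map_laurentMonomial_toLaurent ψ hψ hv
    rw [← hr0, hψ, hvα] at h2
    have h3 := toLaurent_apply_eq_zero hα r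
    rw [h2] at h3
    simp at h3
  · have hg0 := awayGraded_eq_span (k := k) hv
    have hgl := awayGraded_eq_span (k := k) hv'
    rw [hvα] at hg0
    rw [hvα'] at hgl
    unfold ishidaH1Graded
    apply le_antisymm
    · rintro _ ⟨⟨⟨a, b⟩, hab⟩, hmem, rfl⟩
      obtain ⟨ha, hb⟩ : a ∈ awayGraded k 0 α ∧ b ∈ awayGraded k (Fin.last (m + 1)) α := hmem
      rw [hg0, Submodule.mem_span_singleton] at ha
      rw [hgl, Submodule.mem_span_singleton] at hb
      obtain ⟨c, rfl⟩ := ha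
      obtain ⟨d, rfl⟩ := hb
      have hz : awayLast k (d • laurentMonomial k (Fin.last (m + 1)) v') -
        awayFirst k (c • laurentMonomial k 0 v) = 0 := hab
      have e1 : awayLast k (d • laurentMonomial k (Fin.last (m + 1)) v') =
          d • awayLast k (laurentMonomial k (Fin.last (m + 1)) v') :=
        (awayLast k).toLinearMap.map_smul_of_tower d _
      have e2 : awayFirst k (c • laurentMonomial k 0 v) = c • awayFirst k (laurentMonomial k 0 v) :=
        (awayFirst k).toLinearMap.map_smul_of_tower c _
      -- Both monomials have the same nonzero image, so the cocycle condition on the pair says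
      -- exactly `d = c`.
      rw [e1, e2, ← heq, ← sub_smul, smul_eq_zero, or_iff_left hne, sub_eq_zero] at hz
      subst hz
      rw [Submodule.mem_span_singleton]
      exact ⟨d, ((ishidaClass k).map_smul d _).symm⟩
    · rw [Submodule.span_singleton_le_iff_mem]
      refine ⟨⟨_, hker⟩, ⟨?_, ?_⟩, rfl⟩
      · rw [hg0]; exact Submodule.mem_span_singleton_self _
      · rw [hgl]; exact Submodule.mem_span_singleton_self _

end Cohomology

/-! ### Exponents and nonvanishing of the polar series. -/

section PolarSeries

variable {m : ℕ} {k d : Fin (m + 2) → ℕ} {b : Fin (m + 2)} {N : ℕ} {l : ℂ}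

/-- Used with `g = 1` for the length of a partition and with `g = id` for its sum; these give the
two coordinates of the degree. -/
theorem sum_mul_count (hd : Function.Injective d) (g : ℕ → ℕ) (L : List ℕ)
    (hL : ∀ a ∈ L, ∃ i, i ≠ b ∧ d i = a) :
    ∑ i ∈ Finset.univ.erase b, g (d i) * L.count (d i) = (L.map g).sum := by
  induction L with
  | nil => simp
  | cons a L ih =>
    obtain ⟨j, hj, rfl⟩ := hL a (by simp)
    have h : ∀ i, g (d i) * (d j :: L).count (d i) =
        g (d i) * L.count (d i) + if i = j then g (d j) else 0 := by
      intro i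
      by_cases hij : i = j
      · subst hij; simp [mul_add]
      · have : d j ≠ d i := fun h => hij (hd h).symm
        simp [hij, List.count_cons_of_ne this]
    simp only [h, Finset.sum_add_distrib, ih fun a ha => hL a (List.mem_cons_of_mem _ ha)]
    simp [hj, add_comm]

/-- The exponent of the monomial belonging to `c`, as an integer vector. -/
def intExponent (d : Fin (m + 2) → ℕ) (b : Fin (m + 2)) (t : ℤ) (c : Composition N) :
    Fin (m + 2) → ℤ :=
  fun i => if i = b then t - c.length else partMultiplicity d c i

theorem polarExponent_intCast (t : ℤ) (c : Composition N) (i : Fin (m + 2)) :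
    polarExponent d b (t : ℂ) c i = (intExponent d b t c i : ℂ) := by
  unfold polarExponent intExponent
  split_ifs <;> simp

theorem intExponent_nonneg (t : ℤ) (c : Composition N) {i : Fin (m + 2)} (hi : i ≠ b) :
    0 ≤ intExponent d b t c i := by
  simp [intExponent, hi]

theorem mem_orderedPartitions {c : Composition N} :
    c ∈ orderedPartitions d b N ↔ ∀ a ∈ c.blocks, ∃ i, i ≠ b ∧ d i = a := by
  simp [orderedPartitions]

theorem sum_intExponent (hd : Function.Injective d) (t : ℤ) {c : Composition N}
    (hc : c ∈ orderedPartitions d b N) : ∑ i, intExponent d b t c i = t := by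
  have h := sum_mul_count hd (fun _ => 1) c.blocks (mem_orderedPartitions.1 hc)
  rw [← Finset.add_sum_erase _ _ (Finset.mem_univ b)]
  have h2 : ∑ i ∈ Finset.univ.erase b, intExponent d b t c i = (c.length : ℤ) := by
    have h3 : c.length = ∑ i ∈ Finset.univ.erase b, c.blocks.count (d i) := by
      simpa using h.symm
    rw [h3]
    push_cast
    refine Finset.sum_congr rfl fun i hi => ?_
    simp [intExponent, Finset.ne_of_mem_erase hi, partMultiplicity]
  rw [h2]
  simp [intExponent]

theorem sum_mul_intExponent (hd : Function.Injective d) (hb : d b = 0) (t : ℤ)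
    {c : Composition N} (hc : c ∈ orderedPartitions d b N) :
    ∑ i, (d i : ℤ) * intExponent d b t c i = N := by
  have h := sum_mul_count hd id c.blocks (mem_orderedPartitions.1 hc)
  rw [← Finset.add_sum_erase _ _ (Finset.mem_univ b), hb]
  have h3 : N = ∑ i ∈ Finset.univ.erase b, d i * c.blocks.count (d i) := by
    simpa using h.symm
  conv_rhs => rw [h3]
  push_cast
  rw [zero_mul, zero_add]
  refine Finset.sum_congr rfl fun i hi => ?_
  simp [intExponent, Finset.ne_of_mem_erase hi, partMultiplicity]

theorem orderedPartitions_nonempty (hd : Function.Injective d) (hb : d b = 0)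
    {u : Fin (m + 2) →₀ ℕ} (hu : ∑ j, d j * u j = N) : (orderedPartitions d b N).Nonempty := by
  have h : ∃ L : List ℕ, (∀ a ∈ L, ∃ i, i ≠ b ∧ d i = a) ∧ L.sum = ∑ j, d j * u j := by
    clear hu
    induction u using induction_add_single with
    | zero => exact ⟨[], by simp, by simp⟩
    | add_single u j ih =>
      obtain ⟨L, hL, hs⟩ := ih
      have hsum : ∑ i, d i * (u + Finsupp.single j 1 : Fin (m + 2) →₀ ℕ) i =
          d j + ∑ i, d i * u i := by
        simp [mul_add, Finset.sum_add_distrib, Finsupp.single_apply, add_comm]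
      by_cases hj : j = b
      · exact ⟨L, hL, by rw [hsum, hj, hb, zero_add, hs]⟩
      · refine ⟨d j :: L, ?_, by rw [hsum, List.sum_cons, hs]⟩
        intro a ha
        rcases List.mem_cons.1 ha with rfl | ha
        · exact ⟨j, hj, rfl⟩
        · exact hL a ha
  obtain ⟨L, hL, hs⟩ := h
  refine ⟨⟨L, fun {a} ha => ?_, hs.trans hu⟩, mem_orderedPartitions.2 hL⟩
  obtain ⟨i, hi, rfl⟩ := hL a ha
  exact Nat.pos_of_ne_zero fun h => hi (hd (h.trans hb.symm))

theorem exists_length_eq_minLength (h : (orderedPartitions d b N).Nonempty) :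
    ∃ c ∈ orderedPartitions d b N, c.length = minLength d b N := by
  obtain ⟨c, hc⟩ := h
  exact Nat.sInf_mem (s := Composition.length '' (orderedPartitions d b N : Set (Composition N)))
    ⟨_, c, hc, rfl⟩

/-- No cancellation occurs between the terms of the series. -/
theorem polarSeries_support_nonempty (hd : Function.Injective d) (hb : d b = 0)
    (h : (orderedPartitions d b N).Nonempty) (hl : ∀ i : ℕ, minLength d b N ≤ i → l ≠ i) :
    (polarSeries d b N l).support.Nonempty := by
  classical
  obtain ⟨c₀, hc₀⟩ := h
  refine ⟨polarExponent d b l c₀, ?_⟩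
  rw [Finsupp.mem_support_iff, polarSeries, Finsupp.finsetSum_apply]
  simp only [Finsupp.single_apply]
  rw [← Finset.sum_filter]
  -- The exponent fixes the length and the multiplicities, hence the factor `C`. Only the partial
  -- sums depend on the order of the parts, and they contribute the positive real `q c`.
  let C : ℂ := (∏ i ∈ Finset.Ico (minLength d b N) c₀.length, (l - i)) *
    ∏ i ∈ Finset.univ.erase b, (d i : ℂ) ^ partMultiplicity d c₀ i
  let q : Composition N → ℝ := fun c => ∏ i ∈ Finset.Ico 1 c.length, ((N : ℝ) - c.sizeUpTo i)⁻¹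
  have hC : C ≠ 0 := by
    refine mul_ne_zero (Finset.prod_ne_zero_iff.2 fun i hi => ?_)
      (Finset.prod_ne_zero_iff.2 fun i hi => pow_ne_zero _ ?_)
    · exact sub_ne_zero.2 (hl i (Finset.mem_Ico.1 hi).1)
    · have : d i ≠ 0 := fun h => Finset.ne_of_mem_erase hi (hd (h.trans hb.symm))
      exact_mod_cast this
  have hq : ∀ c : Composition N, 0 < q c := by
    intro c
    refine Finset.prod_pos fun i hi => inv_pos.2 (sub_pos.2 ?_)
    exact_mod_cast (c.sizeUpTo_strict_mono (Finset.mem_Ico.1 hi).2).trans_le (c.sizeUpTo_le _)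
  have hterm : ∀ c ∈ (orderedPartitions d b N).filter
      (fun c => polarExponent d b l c = polarExponent d b l c₀), polarCoeff d b l c = C * q c := by
    intro c hc
    have he := (Finset.mem_filter.1 hc).2
    have hlen : c.length = c₀.length := by
      have := congrFun he b
      simp only [polarExponent, if_true, sub_right_inj] at this
      exact_mod_cast this
    have hmul : ∀ i ∈ Finset.univ.erase b, (d i : ℂ) ^ partMultiplicity d c i =
        (d i : ℂ) ^ partMultiplicity d c₀ i := by
      intro i hi
      have := congrFun he i
      simp only [polarExponent, if_neg (Finset.ne_of_mem_erase hi), Nat.cast_inj] at this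
      rw [this]
    simp only [polarCoeff, C, q, hlen, Finset.prod_congr rfl hmul]
    push_cast
    ring
  rw [Finset.sum_congr rfl hterm, ← Finset.mul_sum]
  refine mul_ne_zero hC ?_
  have hpos : 0 < ∑ c ∈ (orderedPartitions d b N).filter
      (fun c => polarExponent d b l c = polarExponent d b l c₀), q c :=
    Finset.sum_pos (fun c _ => hq c) ⟨c₀, Finset.mem_filter.2 ⟨hc₀, rfl⟩⟩
  exact_mod_cast hpos.ne'

theorem exists_of_mem_support_polarSeries {w : Fin (m + 2) → ℂ}
    (hw : w ∈ (polarSeries d b N l).support) :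
    ∃ c ∈ orderedPartitions d b N, w = polarExponent d b l c := by
  classical
  obtain ⟨c, hc, h⟩ := Finset.mem_biUnion.1 (Finsupp.support_finsetSum hw)
  exact ⟨c, hc, Finset.mem_singleton.1 (Finsupp.support_single_subset h)⟩

/-- In a degree `α ∉ ℕA` on the polar line, the series is nonzero and its exponents are integer
vectors of degree `α`. -/
theorem polarSeries_of_degree {α : Fin 2 → ℤ}
    (hα : ¬ ∃ u : Fin (m + 2) → ℕ, (curveMatrix k).mulVec (fun j => (u j : ℤ)) = α)
    (hd : Function.Injective d) (hb : d b = 0)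
    (hdeg : ∀ v : Fin (m + 2) → ℤ, ∑ i, v i = α 0 → ∑ i, (d i : ℤ) * v i = N →
      (curveMatrix k).mulVec v = α)
    {u : Fin (m + 2) →₀ ℕ} (hu : ∑ j, d j * u j = N) :
    (polarSeries d b N (α 0 : ℂ)).support.Nonempty ∧
      ∀ w ∈ (polarSeries d b N (α 0 : ℂ)).support, ∃ v : Fin (m + 2) → ℤ,
        (∀ i, w i = (v i : ℂ)) ∧ (∀ i, i ≠ b → 0 ≤ v i) ∧ (curveMatrix k).mulVec v = α := by
  have hne := orderedPartitions_nonempty hd hb hu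
  have hmul : ∀ c ∈ orderedPartitions d b N,
      (curveMatrix k).mulVec (intExponent d b (α 0) c) = α := fun c hc =>
    hdeg _ (sum_intExponent hd _ hc) (sum_mul_intExponent hd hb _ hc)
  constructor
  -- If `α 0 = i` with `i` at least the minimal length, then a shortest partition has a nonnegative
  -- exponent also at `b`, which exhibits `α` in `ℕA`.
  · refine polarSeries_support_nonempty hd hb hne fun i hi hli => hα ?_
    have hli' : α 0 = i := by exact_mod_cast hli
    obtain ⟨c, hc, hlen⟩ := exists_length_eq_minLength hne
    refine ⟨fun j => (intExponent d b (α 0) c j).toNat, ?_⟩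
    refine Eq.trans (congrArg _ (funext fun j => Int.toNat_of_nonneg ?_)) (hmul c hc)
    by_cases hj : j = b
    · simp only [intExponent, hj, if_true]; omega
    · exact intExponent_nonneg _ _ hj
  · intro w hw
    obtain ⟨c, hc, rfl⟩ := exists_of_mem_support_polarSeries hw
    exact ⟨intExponent d b (α 0) c, polarExponent_intCast _ c,
      fun i hi => intExponent_nonneg _ _ hi, hmul c hc⟩

end PolarSeries

theorem mulVec_curveMatrix {m : ℕ} (k : Fin (m + 2) → ℕ) (v : Fin (m + 2) → ℤ) (α : Fin 2 → ℤ)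
    (h0 : ∑ i, v i = α 0) (h1 : ∑ i, (k i : ℤ) * v i = α 1) : (curveMatrix k).mulVec v = α := by
  funext i
  fin_cases i
  · simpa [curveMatrix, Matrix.mulVec, dotProduct] using h0
  · simpa [curveMatrix, Matrix.mulVec, dotProduct] using h1

end MonomialCurve

/-! ### The main theorem. -/

open MonomialCurve in
theorem mainTheorem10 {m : ℕ} (k : Fin (m + 2) → ℕ) (hk : StrictMono k) (hk0 : k 0 = 0)
    (hgcd : Finset.univ.gcd k = 1) (β : Fin 2 → ℂ) (hβ : β ∈ rankJumping k) :
    ∃ (α : Fin 2 → ℤ) (N N' : ℕ),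
      (∀ i, β i = (α i : ℂ)) ∧ β 1 = (N : ℂ) ∧
      (k (Fin.last (m + 1)) : ℂ) * β 0 - β 1 = (N' : ℂ) ∧
      (polarSolutionFirst k N (β 0)).support.Nonempty ∧
      (polarSolutionLast k N' (β 0)).support.Nonempty ∧
      ∀ w ∈ (polarSolutionFirst k N (β 0)).support,
      ∀ w' ∈ (polarSolutionLast k N' (β 0)).support,
        ∃ v v' : Fin (m + 2) → ℤ,
          (∀ i, w i = (v i : ℂ)) ∧ (∀ i, w' i = (v' i : ℂ)) ∧
          (∀ i, i ≠ 0 → 0 ≤ v i) ∧ (∀ i, i ≠ Fin.last (m + 1) → 0 ≤ v' i) ∧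
          ∃ h : (laurentMonomial k 0 v, laurentMonomial k (Fin.last (m + 1)) v') ∈
              LinearMap.ker (ishidaD1 k),
            ishidaClass k ⟨_, h⟩ ≠ 0 ∧
            ishidaH1Graded k α = Submodule.span ℂ {ishidaClass k ⟨_, h⟩} := by
  obtain ⟨u, w, hmod, hy, hx, hhole⟩ := exists_of_mem_rankJumping hk hk0 hβ
  have hK := last_pos hk
  have hle : ∀ i, k i ≤ k (Fin.last (m + 1)) := fun i => hk.monotone (Fin.le_last i)
  -- That `u` and `w` lie in one coset is what makes `β 0` an integer: it equals this quotient `t`.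
  obtain ⟨t, ht⟩ : k (Fin.last (m + 1)) ∣ upperDegree k w + lowerDegree k u := by
    refine (Nat.modEq_zero_iff_dvd).1 ((Nat.ModEq.add_left _ hmod).trans ?_)
    exact Nat.modEq_zero_iff_dvd.2 ⟨_, upperDegree_add_lowerDegree hk w⟩
  have hβ0 : β 0 = (t : ℂ) := by
    have hK0 : (k (Fin.last (m + 1)) : ℂ) ≠ 0 := by exact_mod_cast hK.ne'
    have ht' := congrArg (Nat.cast : ℕ → ℂ) ht
    push_cast at ht'
    refine mul_left_cancel₀ hK0 ?_
    linear_combination hx + hy + ht'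
  let α : Fin 2 → ℤ := ![t, lowerDegree k u]
  have hα0 : β 0 = (α 0 : ℂ) := by simp [α, hβ0]
  have hα1 : β 1 = (α 1 : ℂ) := by simp [α, hy]
  have hα : ¬ ∃ v : Fin (m + 2) → ℕ, (curveMatrix k).mulVec (fun j => (v j : ℤ)) = α := by
    rintro ⟨v, hv⟩
    have h0 := congrFun hv 0
    have h1 := congrFun hv 1
    simp only [curveMatrix, Matrix.mulVec, dotProduct, Matrix.of_apply, Matrix.cons_val_zero,
      Matrix.cons_val_one, one_mul, α] at h0 h1
    have h0' : ∑ j, v j = t := by exact_mod_cast h0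
    have h1' : lowerDegree k (Finsupp.equivFunOnFinite.symm v) = lowerDegree k u := by
      have : ∑ j, k j * v j = lowerDegree k u := by exact_mod_cast h1
      simpa [lowerDegree] using this
    have h2 := upperDegree_add_lowerDegree hk (Finsupp.equivFunOnFinite.symm v)
    simp only [Finsupp.coe_equivFunOnFinite_symm] at h2
    rw [h0', ← ht, h1'] at h2
    exact hhole ⟨_, h1', by omega⟩
  have htZ : (upperDegree k w : ℤ) + lowerDegree k u = k (Fin.last (m + 1)) * t := by
    exact_mod_cast ht
  obtain ⟨hne, hsupp⟩ := polarSeries_of_degree (d := k) (b := 0) (N := lowerDegree k u) hα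
    hk.injective hk0 (fun v h0 h1 => mulVec_curveMatrix k v α h0 h1) (u := u) rfl
  -- The second series is the first for the reflected exponents `K - k i`; the second coordinate of
  -- the degree is recovered as `K * t` minus the upper degree.
  obtain ⟨hne', hsupp'⟩ := polarSeries_of_degree (d := fun i => k (Fin.last (m + 1)) - k i)
    (b := Fin.last (m + 1)) (N := upperDegree k w) hα
    (fun i j hij => hk.injective (by have := hle i; have := hle j; grind)) (Nat.sub_self _)
    (fun v h0 h1 => mulVec_curveMatrix k v α h0 (by
      have e : ∀ i, ((k (Fin.last (m + 1)) - k i : ℕ) : ℤ) * v i =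
          k (Fin.last (m + 1)) * v i - k i * v i := fun i => by
        rw [Nat.cast_sub (hle i), sub_mul]
      simp only [e, Finset.sum_sub_distrib, ← Finset.mul_sum, h0] at h1
      simp only [α, Matrix.cons_val_zero, Matrix.cons_val_one] at h1 ⊢
      linarith)) (u := w) rfl
  rw [← hα0] at hne hsupp hne' hsupp'
  refine ⟨α, lowerDegree k u, upperDegree k w, ?_, hy, hx, hne, hne', ?_⟩
  · intro i
    fin_cases i
    · exact hα0
    · exact hα1
  · intro z hz z' hz'
    obtain ⟨v, hzv, hv, hvα⟩ := hsupp z hz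
    obtain ⟨v', hzv', hv', hvα'⟩ := hsupp' z' hz'
    exact ⟨v, v', hzv, hzv', hv, hv', ishidaH1Graded_eq_span hα hv hv' hvα hvα'⟩
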